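/- Let $n,k,\delta$ be integers with $1\le k<n$, $\delta\ge 0$ and $(n-k)\mid\delta$. Definitions. Let $F$ be a field. An $(n,k,\delta)$ convolutional code over $F$ is a free $F[z]$-submodule $\mathfrak C\subseteq F[z]^n$ of rank $k$ such that, for a (equivalently, every) generator matrix $G\in F[z]^{n\times k}$ (full column rank, $\mathfrak C=\{Gm : m\in F[z]^k\}$), the maximal degree of the $k\times k$ minors of $G$ is $\delta$. It is non-catastrophic if $G$ is right prime, i.e. $G(z)$ has full column rank for all $z\in\overline F$. A parity-check matrix of $\mathfrak C$ is a matrix $H\in F[z]^{(n-k)\times n}$ of full row rank with $\mathfrak C=\{v\in F[z]^n : Hv=0\}$; $H$ is left prime if $H(z)$ has full row rank for all $z\in\overline F$, and row proper if the matrix of its highest row degree coefficients has full row rank. For $H=H_0+H_1z+\cdots+H_\nu z^\nu$ with $\nu=\deg H$ and $L=\lfloor\frac{\delta}{n-k}\rfloor+\lfloor\frac{\delta}{k}\rfloor$, the partial parity-check matrix is $$\mathfrak H=\begin{pmatrix}H_\nu&\cdots&H_0&&0\\&\ddots&&\ddots&\\0&&H_\nu&\cdots&H_0\end{pmatrix}\in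 F^{(L+1)(n-k)\times(\nu+L+1)n}.$$ A full size minor of $\mathfrak H$, given by a choice of $(L+1)(n-k)$ columns, is trivially zero if it vanishes identically as a polynomial in the entries of $H_0,\dots,H_\nu$ regarded as independent indeterminates. The code $\mathfrak C$ is complete MDP if it has a left prime and row proper parity-check matrix and, for every such parity-check matrix, every full size minor of $\mathfrak H$ that is not trivially zero is nonzero. The set of non-catastrophic $(n,k,\delta)$ codes over an algebraically closed field $K$ is regarded as a quasi-projective variety through the Plücker embedding, which sends a code with generator matrix $G$ to the point of projective space whose homogeneous coordinates are the coefficients of $z^0,\dots,z^\delta$ in all $k\times k$ minors of $G$; it carries the induced Zariski topology. Theorem. 1. For every algebraically closed field $K$, the complete MDP $(n,k,\delta)$ convolutional codes form a generic subset, i.e. a nonempty, Zariski-open and Zariski-dense subset, of the variety of all non-catastrophic $(n,k,\delta)$ convolutional codes over $K$. 2. There is an integer $N=N(n,k,\delta)$ such that over every (finite or infinite) field $F$ with at least $N$ elements there exists a complete MDP $(n,k,\delta)$ convolutional code. -/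

import Mathlib

open Polynomial
open scoped LinearAlgebra.Projectivization

noncomputable section

namespace ConvCode

/-! ### Polynomial matrices -/

section PolynomialMatrices

variable {F : Type*} [Field F]

/-- The value `M(z)` of a polynomial matrix at a point `z` of the algebraic closure. -/
def evalMatrix {m n : ℕ} (M : Matrix (Fin m) (Fin n) F[X]) (z : AlgebraicClosure F) :
    Matrix (Fin m) (Fin n) (AlgebraicClosure F) :=
  M.map fun p => aeval z p

/-- `G` has full column rank at every point of the algebraic closure. -/
def IsRightPrime {n k : ℕ} (G : Matrix (Fin n) (Fin k) F[X]) : Prop :=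
  ∀ z : AlgebraicClosure F, LinearIndependent (AlgebraicClosure F) (evalMatrix G z).col

/-- `H` has full row rank at every point of the algebraic closure. -/
def IsLeftPrime {r n : ℕ} (H : Matrix (Fin r) (Fin n) F[X]) : Prop :=
  ∀ z : AlgebraicClosure F, LinearIndependent (AlgebraicClosure F) (evalMatrix H z).row

/-- The degree of the `i`-th row, i.e. the maximal degree of its entries. -/
def rowDegree {r n : ℕ} (H : Matrix (Fin r) (Fin n) F[X]) (i : Fin r) : ℕ :=
  Finset.univ.sup fun j => (H i j).natDegree

/-- The degree of a polynomial matrix, i.e. the maximal degree of its entries. -/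
def matrixDegree {r n : ℕ} (H : Matrix (Fin r) (Fin n) F[X]) : ℕ :=
  Finset.univ.sup fun i => rowDegree H i

/-- The matrix of the highest row degree coefficients has full row rank. -/
def IsRowProper {r n : ℕ} (H : Matrix (Fin r) (Fin n) F[X]) : Prop :=
  LinearIndependent F (Matrix.of fun i j => (H i j).coeff (rowDegree H i)).row

/-- The `k × k` minor of `G` formed by the rows `I 0 < ⋯ < I (k - 1)`. -/
def rowMinor {n k : ℕ} (G : Matrix (Fin n) (Fin k) F[X]) (I : Fin k ↪o Fin n) : F[X] :=
  (G.submatrix I id).det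

/-- The maximal degree of the `k × k` minors of `G`. -/
def maxMinorDegree {n k : ℕ} (G : Matrix (Fin n) (Fin k) F[X]) : ℕ :=
  Finset.univ.sup fun I : Fin k ↪o Fin n => (rowMinor G I).natDegree

/-- `G` is a generator matrix of `C`: it has full column rank and `C = {G m | m ∈ F[z]^k}`. -/
def IsGeneratorMatrix {n k : ℕ} (G : Matrix (Fin n) (Fin k) F[X])
    (C : Submodule F[X] (Fin n → F[X])) : Prop :=
  LinearIndependent F[X] G.col ∧ C = LinearMap.range G.mulVecLin

/-- `H` is a parity-check matrix of `C`: it has full row rank and `C = {v | H v = 0}`. -/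
def IsParityCheckMatrix {r n : ℕ} (H : Matrix (Fin r) (Fin n) F[X])
    (C : Submodule F[X] (Fin n → F[X])) : Prop :=
  LinearIndependent F[X] H.row ∧ C = LinearMap.ker H.mulVecLin

/-- A parity-check matrix that is left prime and row proper. -/
def IsMinimalParityCheckMatrix {r n : ℕ} (H : Matrix (Fin r) (Fin n) F[X])
    (C : Submodule F[X] (Fin n → F[X])) : Prop :=
  IsParityCheckMatrix H C ∧ IsLeftPrime H ∧ IsRowProper H

end PolynomialMatrices

/-! ### The partial parity-check matrix -/

/-- For coefficient matrices `A 0, …, A ν`, the block matrix with `L + 1` block rows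
and `ν + L + 1` block columns
```
A ν  ⋯  A 0           0
      ⋱      ⋱
0          A ν  ⋯  A 0
```
-/
def partialParityCheck {R : Type*} [CommRing R] {r n : ℕ}
    (A : ℕ → Matrix (Fin r) (Fin n) R) (ν L : ℕ) :
    Matrix (Fin (L + 1) × Fin r) (Fin (ν + L + 1) × Fin n) R :=
  Matrix.of fun p q =>
    if p.1.val ≤ q.1.val ∧ q.1.val ≤ p.1.val + ν then
      A (p.1.val + ν - q.1.val) p.2 q.2
    else 0

/-- The full size minor formed by the columns `J`. The columns are listed by an injective map,
without requiring a particular order; reordering them changes only the sign. -/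
def fullMinor {R : Type*} [CommRing R] {r n : ℕ}
    (A : ℕ → Matrix (Fin r) (Fin n) R) (ν L : ℕ)
    (J : Fin (L + 1) × Fin r ↪ Fin (ν + L + 1) × Fin n) : R :=
  ((partialParityCheck A ν L).submatrix id J).det

/-- Coefficient matrices `A 0, A 1, …` all of whose entries are independent indeterminates
(only those of `A 0, …, A ν` occur in `partialParityCheck A ν L`). -/
def genericCoeff (F : Type*) [Field F] (r n : ℕ) :
    ℕ → Matrix (Fin r) (Fin n) (MvPolynomial (ℕ × Fin r × Fin n) F) :=
  fun i => Matrix.of fun a b => MvPolynomial.X (i, a, b)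

/-- The full size minor formed by the columns `J` is trivially zero: it vanishes identically in
the entries of the coefficient matrices. -/
def IsTriviallyZero (F : Type*) [Field F] {r n : ℕ} (ν L : ℕ)
    (J : Fin (L + 1) × Fin r ↪ Fin (ν + L + 1) × Fin n) : Prop :=
  fullMinor (genericCoeff F r n) ν L J = 0

/-- The coefficient matrices of a polynomial matrix `H(z) = H_0 + H_1 z + ⋯`. -/
def coeffMatrix {F : Type*} [Field F] {r n : ℕ} (H : Matrix (Fin r) (Fin n) F[X]) (i : ℕ) :
    Matrix (Fin r) (Fin n) F :=
  H.map fun p => p.coeff i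

/-! ### Convolutional codes -/

/-- An `(n, k, δ)` convolutional code: a free submodule of `F[z]^n` of rank `k` whose generator
matrices have maximal degree `δ` of the `k × k` minors. -/
structure ConvolutionalCode (F : Type*) [Field F] (n k δ : ℕ) where
  carrier : Submodule F[X] (Fin n → F[X])
  free : Module.Free F[X] carrier
  rank_eq : Module.finrank F[X] carrier = k
  degree_eq : ∀ G : Matrix (Fin n) (Fin k) F[X],
    IsGeneratorMatrix G carrier → maxMinorDegree G = δ

namespace ConvolutionalCode

variable {F : Type*} [Field F] {n k δ : ℕ}

/-- Every generator matrix is right prime. -/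
def IsNoncatastrophic (C : ConvolutionalCode F n k δ) : Prop :=
  ∀ G : Matrix (Fin n) (Fin k) F[X], IsGeneratorMatrix G C.carrier → IsRightPrime G

/-- Complete MDP codes. With `L = ⌊δ/(n-k)⌋ + ⌊δ/k⌋`, for any left prime and row proper
parity-check matrix `H` of the code (such a matrix being required to exist), every full size minor
of the partial parity-check matrix of `H` that is not trivially zero is nonzero. -/
def IsCompleteMDP (C : ConvolutionalCode F n k δ) : Prop :=
  (∃ H : Matrix (Fin (n - k)) (Fin n) F[X], IsMinimalParityCheckMatrix H C.carrier) ∧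
  ∀ H : Matrix (Fin (n - k)) (Fin n) F[X], IsMinimalParityCheckMatrix H C.carrier →
    ∀ J : Fin (δ / (n - k) + δ / k + 1) × Fin (n - k) ↪
        Fin (matrixDegree H + (δ / (n - k) + δ / k) + 1) × Fin n,
      ¬ IsTriviallyZero F (matrixDegree H) (δ / (n - k) + δ / k) J →
        fullMinor (coeffMatrix H) (matrixDegree H) (δ / (n - k) + δ / k) J ≠ 0

theorem exists_generatorMatrix (C : ConvolutionalCode F n k δ) :
    ∃ G : Matrix (Fin n) (Fin k) F[X], IsGeneratorMatrix G C.carrier := by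
  have := C.free
  let b : Module.Basis (Fin k) F[X] C.carrier := Module.finBasisOfFinrankEq F[X] C.carrier C.rank_eq
  refine ⟨Matrix.of fun i j => (b j : Fin n → F[X]) i, ?_, ?_⟩
  · have h := b.linearIndependent.map' C.carrier.subtype (Submodule.ker_subtype _)
    exact h
  · rw [Matrix.range_mulVecLin]
    have h : Set.range (Matrix.of fun i j => (b j : Fin n → F[X]) i).col
        = C.carrier.subtype '' Set.range b := by
      rw [← Set.range_comp]
      rfl
    rw [h, ← Submodule.map_span, b.span_eq, Submodule.map_top, Submodule.range_subtype]

/-- A generator matrix of the code (unique up to right multiplication by a unimodular matrix). -/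
def generatorMatrix (C : ConvolutionalCode F n k δ) : Matrix (Fin n) (Fin k) F[X] :=
  C.exists_generatorMatrix.choose

theorem generatorMatrix_spec (C : ConvolutionalCode F n k δ) :
    IsGeneratorMatrix C.generatorMatrix C.carrier :=
  C.exists_generatorMatrix.choose_spec

end ConvolutionalCode

/-! ### The variety of non-catastrophic codes -/

/-- A matrix over a field with linearly independent columns has a nonzero maximal minor. -/
theorem exists_minor_ne_zero {E : Type*} [Field E] {n k : ℕ} (M : Matrix (Fin n) (Fin k) E)
    (h : LinearIndependent E M.col) :
    ∃ I : Fin k ↪o Fin n, (M.submatrix I id).det ≠ 0 := by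
  have hr : Module.finrank E (Submodule.span E (Set.range M.row)) = k := by
    rw [← Matrix.rank_eq_finrank_span_row, ← Matrix.rank_transpose]
    simpa using LinearIndependent.rank_matrix (M := M.transpose) h
  obtain ⟨f, hf, -, hli⟩ := Submodule.exists_fun_fin_finrank_span_eq E (Set.range M.row)
  choose g hg using hf
  let e : Fin k → Fin n := fun i => g (Fin.cast hr.symm i)
  have he : LinearIndependent E (M.submatrix e id).row := by
    have h1 := hli.comp (Fin.cast hr.symm) (Fin.cast_injective _)
    have h2 : (M.submatrix e id).row = f ∘ Fin.cast hr.symm := by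
      funext i
      exact hg _
    rw [h2]
    exact h1
  have hinj : Function.Injective e := by
    intro a b hab
    apply he.injective
    simp only [Matrix.row]
    ext j
    simp [hab]
  have hcard : (Finset.univ.image e).card = k := by
    simp [Finset.card_image_of_injective _ hinj]
  let I : Fin k ↪o Fin n := (Finset.univ.image e).orderEmbOfFin hcard
  have hI : ∀ i, ∃ j, I j = e i := by
    intro i
    have : e i ∈ Set.range I := by
      rw [Finset.range_orderEmbOfFin]
      simp
    exact this
  choose s hs using hI
  have hsinj : Function.Injective s := by
    intro a b hab
    apply hinj
    rw [← hs a, ← hs b, hab]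
  refine ⟨I, fun h0 => ?_⟩
  have hdet : (M.submatrix e id).det ≠ 0 := by
    have := Matrix.linearIndependent_rows_iff_isUnit.1 he
    exact ((Matrix.isUnit_iff_isUnit_det _).1 this).ne_zero
  apply hdet
  have hperm : M.submatrix e id
      = (M.submatrix I id).submatrix (Equiv.ofBijective s (Finite.injective_iff_bijective.1 hsinj))
          id := by
    ext i j
    simp [hs]
  rw [hperm, Matrix.det_permute, h0, mul_zero]

/-- The non-catastrophic `(n, k, δ)` convolutional codes. -/
abbrev NoncatastrophicCode (F : Type*) [Field F] (n k δ : ℕ) : Type _ :=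
  {C : ConvolutionalCode F n k δ // C.IsNoncatastrophic}

/-- The index set of the Plücker coordinates: a choice of `k` rows and an exponent `0, …, δ`. -/
abbrev PluckerIndex (n k δ : ℕ) : Type := (Fin k ↪o Fin n) × Fin (δ + 1)

/-- The coefficients of `z^0, …, z^δ` of all `k × k` minors of `G`. -/
def pluckerVector {F : Type*} [Field F] {n k : ℕ} (δ : ℕ) (G : Matrix (Fin n) (Fin k) F[X]) :
    PluckerIndex n k δ → F :=
  fun q => (rowMinor G q.1).coeff q.2.val

theorem pluckerVector_ne_zero {F : Type*} [Field F] {n k δ : ℕ}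
    (C : NoncatastrophicCode F n k δ) : pluckerVector δ C.1.generatorMatrix ≠ 0 := by
  have hG := C.1.generatorMatrix_spec
  obtain ⟨I, hI⟩ := exists_minor_ne_zero _ (C.2 _ hG 0)
  have hmin : rowMinor C.1.generatorMatrix I ≠ 0 := by
    intro h0
    apply hI
    have h1 : (evalMatrix C.1.generatorMatrix 0).submatrix I id
        = (aeval (R := F) (0 : AlgebraicClosure F)).mapMatrix
            (C.1.generatorMatrix.submatrix I id) := rfl
    rw [h1, ← AlgHom.map_det]
    change aeval (0 : AlgebraicClosure F) (rowMinor C.1.generatorMatrix I) = 0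
    rw [h0, map_zero]
  have hdeg : (rowMinor C.1.generatorMatrix I).natDegree ≤ δ := by
    have h1 : (rowMinor C.1.generatorMatrix I).natDegree ≤ maxMinorDegree C.1.generatorMatrix :=
      Finset.le_sup (f := fun I => (rowMinor C.1.generatorMatrix I).natDegree) (Finset.mem_univ I)
    exact h1.trans_eq (C.1.degree_eq _ hG)
  intro h
  have h2 := congrFun h (I, ⟨_, Nat.lt_succ_of_le hdeg⟩)
  exact hmin (leadingCoeff_eq_zero.1 h2)

/-- The Plücker embedding of the set of non-catastrophic `(n, k, δ)` codes into projective space.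
Another generator matrix changes all minors by one common nonzero scalar. -/
def plucker {F : Type*} [Field F] {n k δ : ℕ} (C : NoncatastrophicCode F n k δ) :
    ℙ F (PluckerIndex n k δ → F) :=
  Projectivization.mk F (pluckerVector δ C.1.generatorMatrix) (pluckerVector_ne_zero C)

/-- The Zariski topology on the projective space with coordinates indexed by `ι`: the sets where a
homogeneous polynomial does not vanish form a basis of it. -/
@[reducible] def projectiveZariskiTopology (F : Type*) [Field F] (ι : Type*) :
    TopologicalSpace (ℙ F (ι → F)) :=
  TopologicalSpace.generateFrom
    {U | ∃ (d : ℕ) (f : MvPolynomial ι F), f.IsHomogeneous d ∧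
      U = {p | MvPolynomial.eval p.rep f ≠ 0}}

/-- The Zariski topology of the quasi-projective variety of non-catastrophic `(n, k, δ)` codes. -/
instance zariskiTopology (F : Type*) [Field F] (n k δ : ℕ) :
    TopologicalSpace (NoncatastrophicCode F n k δ) :=
  TopologicalSpace.induced plucker (projectiveZariskiTopology F (PluckerIndex n k δ))

end ConvCode

end

open Polynomial
open scoped LinearAlgebra.Projectivization

noncomputable section

namespace ConvCode

/-! ### Determinants -/

/-! Put `r = n - k`, `ν = δ / r` and `L = δ / r + δ / k`. The row degrees of a left prime, row
proper parity-check matrix `H` add up to `δ = r ν`. The minor of the partial parity-check matrix on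
the leftmost block diagonal is not trivially zero, and it can be nonzero only if all row degrees
agree, hence equal `ν`. A row vector in the left kernel of the columns `J` is a polynomial vector
`u` such that `u H`, a word of the dual code, vanishes at the positions `J`. So complete MDP is a
property of the dual alone (`hasNonzeroMinors_iff`): no nonzero dual word has degree below `ν`, and
none is supported off `J` when `J` is not trivially zero.

Openness. A word `w` lies in the dual iff `w G = 0`. By Cramer's rule this is a system of linear
equations in `w` whose coefficients are, up to sign, Plücker coordinates (`vecMul_eq_zero_iff`).
That no nonzero `w` with given finite support solves it means that some maximal minor of the system
is nonzero, and such a minor is a form in the Plücker coordinates (`isOpen_setOf_trivialDual`).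

Existence. The minors of `G` are the complementary minors of `H` up to a common constant
(`exists_rowMinor_eq`). That they are coprime of maximal degree exactly `δ` is the nonvanishing of a
Sylvester-type determinant, `shiftMinor`. For a matrix of degree `ν` with indeterminate entries all
these conditions are polynomial; none vanishes identically, by the example `bidiagonal` and by the
definition of trivially zero. Their degrees are bounded independently of the field, because the
polynomials come from `ℤ`; hence a large field contains a point where their product is nonzero.

Density. A code in a given nonempty open set may have unequal row degrees and is then not of the
generic shape. `exists_more_balanced` deforms such a matrix into one with more balanced degrees
without leaving the open set. Once all degrees are at most `ν`, the form defining the open set pulls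
back to a nonzero polynomial in the generic coefficients, and the existence argument applies with
one more factor. -/

theorem span_eq_top_of_dotProduct {K α β : Type*} [Field K] [Fintype β] [DecidableEq β]
    (M : α → β → K) (h : ∀ c : β → K, (∀ a, M a ⬝ᵥ c = 0) → c = 0) :
    Submodule.span K (Set.range M) = ⊤ := by
  by_contra hne
  obtain ⟨g, hg, hle⟩ := Submodule.exists_le_ker_of_lt_top _ (lt_top_iff_ne_top.2 hne)
  have hgv : ∀ v : β → K, g v = v ⬝ᵥ fun b => g (Pi.single b 1) := fun v => by
    conv_lhs => rw [← Finset.univ_sum_single v]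
    rw [map_sum, dotProduct]
    refine Finset.sum_congr rfl fun x _ => ?_
    rw [← smul_eq_mul, ← map_smul, ← Pi.single_smul, smul_eq_mul, mul_one]
  have hc := h (fun b => g (Pi.single b 1)) fun a => by
    rw [← hgv]
    exact hle (Submodule.subset_span ⟨a, rfl⟩)
  refine hg (LinearMap.ext fun v => ?_)
  rw [hgv, hc, dotProduct_zero, LinearMap.zero_apply]

/-- A family of vectors without a common nonzero orthogonal vector has a nonzero maximal minor. -/
theorem exists_det_ne_zero {K α β : Type*} [Field K] [Fintype β] [DecidableEq β]
    (M : α → β → K) (h : ∀ c : β → K, (∀ a, M a ⬝ᵥ c = 0) → c = 0) :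
    ∃ e : β → α, (Matrix.of fun b => M (e b)).det ≠ 0 := by
  have htop := span_eq_top_of_dotProduct M h
  obtain ⟨f, hf, -, hli⟩ := Submodule.exists_fun_fin_finrank_span_eq K (Set.range M)
  have hcard : Fintype.card β = Module.finrank K (Submodule.span K (Set.range M)) := by
    rw [htop, finrank_top, Module.finrank_fintype_fun_eq_card]
  let u : β ≃ Fin (Module.finrank K (Submodule.span K (Set.range M))) :=
    Fintype.equivFinOfCardEq hcard
  choose g hg using hf
  refine ⟨fun b => g (u b), ?_⟩
  have hli' : LinearIndependent K (Matrix.of fun b => M (g (u b))).row := by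
    have h1 : (Matrix.of fun b => M (g (u b))).row = f ∘ u := funext fun b => hg _
    rw [h1]
    exact hli.comp u u.injective
  exact ((Matrix.isUnit_iff_isUnit_det _).1
    (Matrix.linearIndependent_rows_iff_isUnit.1 hli')).ne_zero

theorem eq_zero_of_det_ne_zero {K α β : Type*} [Field K] [Fintype β] [DecidableEq β]
    (M : α → β → K) (e : β → α) (he : (Matrix.of fun b => M (e b)).det ≠ 0) (c : β → K)
    (hc : ∀ a, M a ⬝ᵥ c = 0) : c = 0 :=
  Matrix.eq_zero_of_mulVec_eq_zero he (funext fun b => hc (e b))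

theorem isHomogeneous_det {R σ β : Type*} [CommRing R] [Fintype β] [DecidableEq β]
    (M : Matrix β β (MvPolynomial σ R)) (h : ∀ i j, (M i j).IsHomogeneous 1) :
    M.det.IsHomogeneous (Fintype.card β) := by
  rw [Matrix.det_apply]
  refine MvPolynomial.IsHomogeneous.sum _ _ _ fun s _ => ?_
  have h1 := MvPolynomial.IsHomogeneous.prod Finset.univ (fun i => M (s i) i) (fun _ => 1)
    fun i _ => h (s i) i
  rcases Int.units_eq_one_or (Equiv.Perm.sign s) with h2 | h2
  · simpa [h2] using h1
  · simpa [h2] using h1.neg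

theorem natDegree_prod_le_and_coeff {R ι : Type*} [CommRing R] (s : Finset ι) (p : ι → R[X])
    (d : ι → ℕ) (h : ∀ i ∈ s, (p i).natDegree ≤ d i) :
    (∏ i ∈ s, p i).natDegree ≤ ∑ i ∈ s, d i ∧
      (∏ i ∈ s, p i).coeff (∑ i ∈ s, d i) = ∏ i ∈ s, (p i).coeff (d i) := by
  classical
  induction s using Finset.induction_on with
  | empty => simp
  | insert a s ha ih =>
    obtain ⟨h1, h2⟩ := ih fun i hi => h i (Finset.mem_insert_of_mem hi)
    have h3 := h a (Finset.mem_insert_self a s)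
    rw [Finset.prod_insert ha, Finset.prod_insert ha, Finset.sum_insert ha]
    exact ⟨natDegree_mul_le_of_le h3 h1, by rw [coeff_mul_add_eq_of_natDegree_le h3 h1, h2]⟩

theorem natDegree_det_le {R β : Type*} [CommRing R] [Fintype β] [DecidableEq β]
    (M : Matrix β β R[X]) (d : β → ℕ) (h : ∀ i j, (M i j).natDegree ≤ d i) :
    M.det.natDegree ≤ ∑ i, d i := by
  rw [← Matrix.det_transpose, Matrix.det_apply]
  refine natDegree_sum_le_of_forall_le _ _ fun s _ => ?_
  refine (natDegree_smul_le _ _).trans ?_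
  refine (natDegree_prod_le_and_coeff _ _ d fun i _ => ?_).1
  exact h _ _

theorem coeff_det_sum {R β : Type*} [CommRing R] [Fintype β] [DecidableEq β]
    (M : Matrix β β R[X]) (d : β → ℕ) (h : ∀ i j, (M i j).natDegree ≤ d i) :
    M.det.coeff (∑ i, d i) = (Matrix.of fun i j => (M i j).coeff (d i)).det := by
  rw [← Matrix.det_transpose, Matrix.det_apply, ← Matrix.det_transpose, Matrix.det_apply,
    finsetSum_coeff]
  refine Finset.sum_congr rfl fun s _ => ?_
  rw [coeff_smul, (natDegree_prod_le_and_coeff _ _ d fun i _ => ?_).2]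
  · rfl
  · exact h _ _

/-! ### Points where a polynomial does not vanish -/

/-- Only finitely many variables occur, and the degree in each is at most the total degree. A grid
with one more value per variable therefore detects a nonzero polynomial. -/
theorem exists_eval_ne_zero {F σ : Type*} [Field F] (P : MvPolynomial σ F) (hP : P ≠ 0)
    (hcard : ((P.totalDegree + 1 : ℕ) : ℕ∞) ≤ ENat.card F) :
    ∃ x : σ → F, MvPolynomial.eval x P ≠ 0 := by
  obtain ⟨s, q, rfl⟩ := MvPolynomial.exists_finset_rename P
  obtain ⟨S, hS⟩ : ∃ S : Finset F, S.card = (MvPolynomial.rename Subtype.val q).totalDegree + 1 := by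
    cases finite_or_infinite F
    · have := Fintype.ofFinite F
      rw [ENat.card_eq_coe_fintype_card, Nat.cast_le] at hcard
      obtain ⟨S, -, hS⟩ := Finset.exists_subset_card_eq (s := (Finset.univ : Finset F)) hcard
      exact ⟨S, hS⟩
    · exact Infinite.exists_subset_card_eq F _
  by_contra! hall
  have hq : q = 0 := by
    refine MvPolynomial.eq_zero_of_eval_zero_at_prod_finset q (fun _ => S) (fun i => ?_)
      fun x _ => ?_
    · rw [hS, ← MvPolynomial.degreeOf_rename_of_injective Subtype.val_injective]
      exact Nat.lt_succ_of_le (MvPolynomial.degreeOf_le_totalDegree _ _)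
    · have h1 := hall (Function.extend Subtype.val x 0)
      rwa [MvPolynomial.eval_rename, Function.extend_comp Subtype.val_injective] at h1
  exact hP (by simp [hq])

/-! ### Prime polynomial matrices -/

section Prime

variable {F : Type*} [Field F]

/-- `F[X]` is a principal ideal domain: a non-unit generator of the ideal would have a root in the
algebraic closure, at which all maximal minors vanish. -/
theorem span_rowMinor_eq_top {n k : ℕ} (G : Matrix (Fin n) (Fin k) F[X]) (hG : IsRightPrime G) :
    Ideal.span (Set.range (rowMinor G)) = ⊤ := by
  by_contra hne
  obtain ⟨g, hg⟩ := (IsPrincipalIdealRing.principal (Ideal.span (Set.range (rowMinor G)))).principal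
  have hgu : ¬ IsUnit g := fun hu => hne (by
    rw [hg]; exact Ideal.span_singleton_eq_top.2 hu)
  obtain ⟨z, hz⟩ : ∃ z : AlgebraicClosure F, aeval z g = 0 := by
    by_cases h0 : g = 0
    · exact ⟨0, by simp [h0]⟩
    · exact IsAlgClosed.exists_aeval_eq_zero _ _ fun hd => hgu (isUnit_iff_degree_eq_zero.2 hd)
  obtain ⟨I, hI⟩ := exists_minor_ne_zero _ (hG z)
  apply hI
  have h1 : (evalMatrix G z).submatrix I id
      = (aeval (R := F) z).mapMatrix (G.submatrix I id) := rfl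
  rw [h1, ← AlgHom.map_det]
  change aeval z (rowMinor G I) = 0
  have h2 : rowMinor G I ∈ Ideal.span (Set.range (rowMinor G)) := Ideal.subset_span ⟨I, rfl⟩
  rw [hg] at h2
  obtain ⟨a, ha⟩ := Submodule.mem_span_singleton.1 h2
  rw [← ha, smul_eq_mul, map_mul, hz, mul_zero]

/-- A Bézout relation between the minors, combined with the adjugates of the corresponding square
submatrices. -/
theorem exists_leftInverse_of_isRightPrime {n k : ℕ} (G : Matrix (Fin n) (Fin k) F[X])
    (hG : IsRightPrime G) : ∃ M : Matrix (Fin k) (Fin n) F[X], M * G = 1 := by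
  have h1 : (1 : F[X]) ∈ Ideal.span (Set.range (rowMinor G)) := by
    rw [span_rowMinor_eq_top G hG]; trivial
  obtain ⟨a, ha⟩ := (Ideal.mem_span_range_iff_exists_fun).1 h1
  refine ⟨∑ I, a I • ((G.submatrix I id).adjugate *
    (1 : Matrix (Fin n) (Fin n) F[X]).submatrix I id), ?_⟩
  rw [Matrix.sum_mul, ← one_smul F[X] (1 : Matrix (Fin k) (Fin k) F[X]), ← ha, Finset.sum_smul]
  refine Finset.sum_congr rfl fun I _ => ?_
  have h2 : (1 : Matrix (Fin n) (Fin n) F[X]).submatrix I id * G = G.submatrix I id := by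
    ext i j
    simp [Matrix.mul_apply, Matrix.one_apply]
  rw [Matrix.smul_mul, Matrix.mul_assoc, h2, Matrix.adjugate_mul, smul_smul, rowMinor]

theorem isRightPrime_of_mul_eq_one {n k : ℕ} (G : Matrix (Fin n) (Fin k) F[X])
    (M : Matrix (Fin k) (Fin n) F[X]) (h : M * G = 1) : IsRightPrime G := by
  intro z
  rw [← Matrix.mulVec_injective_iff]
  have h1 : evalMatrix M z * evalMatrix G z = 1 := by
    have h2 := congrArg (fun A => A.map (aeval (R := F) z)) h
    simp only [Matrix.map_mul] at h2
    exact h2.trans (Matrix.map_one _ (map_zero _) (map_one _))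
  intro x y hxy
  have := congrArg (fun v => (evalMatrix M z).mulVec v) hxy
  simpa [Matrix.mulVec_mulVec, h1] using this

theorem exists_rightInverse_of_isLeftPrime {r n : ℕ} (H : Matrix (Fin r) (Fin n) F[X])
    (hH : IsLeftPrime H) : ∃ Y : Matrix (Fin n) (Fin r) F[X], H * Y = 1 := by
  obtain ⟨M, hM⟩ := exists_leftInverse_of_isRightPrime H.transpose hH
  refine ⟨M.transpose, ?_⟩
  rw [← Matrix.transpose_transpose H, ← Matrix.transpose_mul, hM, Matrix.transpose_one]

theorem isLeftPrime_of_mul_eq_one {r n : ℕ} (H : Matrix (Fin r) (Fin n) F[X])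
    (Y : Matrix (Fin n) (Fin r) F[X]) (h : H * Y = 1) : IsLeftPrime H :=
  isRightPrime_of_mul_eq_one H.transpose Y.transpose (by
    rw [← Matrix.transpose_mul, h, Matrix.transpose_one])

end Prime

/-! ### Dual minors -/

/-- The identification of the columns of an `(r + k) × n` block matrix with its rows. -/
def colEquiv {r k n : ℕ} (h : r + k = n) : Fin r ⊕ Fin k ≃ Fin n :=
  finSumFinEquiv.trans (finCongr h)

/-- The determinant of the matrix whose rows are the rows of `H`, followed by the unit vectors
indexed by `I`. Up to sign, it is the maximal minor of `H` formed by the columns outside `I`. -/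
def dualMinor {R : Type*} [CommRing R] {r k n : ℕ} (h : r + k = n)
    (H : Matrix (Fin r) (Fin n) R) (I : Fin k → Fin n) : R :=
  ((Matrix.fromRows H ((1 : Matrix (Fin n) (Fin n) R).submatrix I id)).submatrix id
    (colEquiv h)).det

section DualMinor

variable {R S : Type*} [CommRing R] [CommRing S] {r k n : ℕ} (h : r + k = n)

theorem dualMinor_map (φ : R →+* S) (H : Matrix (Fin r) (Fin n) R) (I : Fin k → Fin n) :
    dualMinor h (H.map φ) I = φ (dualMinor h H I) := by
  rw [dualMinor, dualMinor, RingHom.map_det]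
  congr 1
  ext (i | i) j
  · simp
  · simp [Matrix.one_apply, apply_ite φ]

theorem dualMinor_mul (U : Matrix (Fin r) (Fin r) R) (H : Matrix (Fin r) (Fin n) R)
    (I : Fin k → Fin n) : dualMinor h (U * H) I = U.det * dualMinor h H I := by
  have h1 : (Matrix.fromRows (U * H) ((1 : Matrix (Fin n) (Fin n) R).submatrix I id)).submatrix id
      (colEquiv h) = Matrix.fromBlocks U 0 0 1 *
        (Matrix.fromRows H ((1 : Matrix (Fin n) (Fin n) R).submatrix I id)).submatrix id
          (colEquiv h) := by
    have h2 := Matrix.fromBlocks_mul_fromRows H ((1 : Matrix (Fin n) (Fin n) R).submatrix I id)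
      U 0 0 (1 : Matrix (Fin k) (Fin k) R)
    rw [Matrix.zero_mul, Matrix.zero_mul, add_zero, zero_add, Matrix.one_mul] at h2
    rw [← h2]
    rfl
  rw [dualMinor, h1, Matrix.det_mul, Matrix.det_fromBlocks_zero₂₁, Matrix.det_one, mul_one,
    dualMinor]

/-- The rows of `H` and the unit rows `I`, multiplied by `[Y G]`, give the block triangular matrix
with diagonal blocks `1` and `G_I`. -/
theorem dualMinor_mul_det (H : Matrix (Fin r) (Fin n) R) (Y : Matrix (Fin n) (Fin r) R)
    (G : Matrix (Fin n) (Fin k) R) (hY : H * Y = 1) (hG : H * G = 0) (I : Fin k → Fin n) :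
    dualMinor h H I * ((Matrix.fromCols Y G).submatrix (colEquiv h) id).det
      = (G.submatrix I id).det := by
  rw [dualMinor, ← Matrix.det_mul, Matrix.submatrix_mul_equiv, Matrix.fromRows_mul_fromCols,
    hY, hG, Matrix.submatrix_id_id, Matrix.det_fromBlocks_zero₁₂, Matrix.det_one, one_mul]
  congr 1
  ext i j
  simp [Matrix.mul_apply, Matrix.one_apply]

theorem isUnit_det_fromCols (H : Matrix (Fin r) (Fin n) R) (Y : Matrix (Fin n) (Fin r) R)
    (G : Matrix (Fin n) (Fin k) R) (M : Matrix (Fin k) (Fin n) R)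
    (hY : H * Y = 1) (hG : H * G = 0) (hM : M * G = 1) :
    IsUnit ((Matrix.fromCols Y G).submatrix (colEquiv h) id).det := by
  refine IsUnit.of_mul_eq_one_right (((Matrix.fromRows H M).submatrix id (colEquiv h)).det) ?_
  rw [← Matrix.det_mul, Matrix.submatrix_mul_equiv, Matrix.fromRows_mul_fromCols,
    hY, hG, hM, Matrix.submatrix_id_id, Matrix.det_fromBlocks_zero₁₂, Matrix.det_one, one_mul,
    Matrix.det_one]

/-- For each `J i` the first `r` columns of the adjugate satisfy the equation up to the factor
`dualMinor h H (J i)`; the Bézout coefficients combine them. -/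
theorem exists_rightInverse_of_sum_dualMinor {ι : Type*} [Fintype ι]
    (H : Matrix (Fin r) (Fin n) R) (J : ι → Fin k → Fin n) (a : ι → R)
    (ha : ∑ i, a i * dualMinor h H (J i) = 1) : ∃ Y : Matrix (Fin n) (Fin r) R, H * Y = 1 := by
  let N : ι → Matrix (Fin r ⊕ Fin k) (Fin r ⊕ Fin k) R := fun i =>
    (Matrix.fromRows H ((1 : Matrix (Fin n) (Fin n) R).submatrix (J i) id)).submatrix id
      (colEquiv h)
  refine ⟨∑ i, a i • ((N i).adjugate.submatrix (colEquiv h).symm Sum.inl), ?_⟩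
  rw [Matrix.mul_sum, ← one_smul R (1 : Matrix (Fin r) (Fin r) R), ← ha, Finset.sum_smul]
  refine Finset.sum_congr rfl fun i _ => ?_
  rw [Matrix.mul_smul, mul_smul]
  congr 1
  ext x y
  have h1 := congrFun (congrFun (Matrix.mul_adjugate (N i)) (Sum.inl x)) (Sum.inl y)
  rw [Matrix.mul_apply] at h1 ⊢
  rw [← (colEquiv h).sum_comp]
  simpa [N, dualMinor, Matrix.one_apply] using h1

end DualMinor

/-! ### Generator matrices and parity-check matrices -/

section ParityCheck

variable {F : Type*} [Field F] {r k n : ℕ}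

theorem finrank_ker_of_surjective {R : Type*} [CommRing R] [IsDomain R] {m n : ℕ}
    (T : (Fin n → R) →ₗ[R] (Fin m → R)) (hT : Function.Surjective T) :
    m + Module.finrank R (LinearMap.ker T) = n := by
  have h1 := Submodule.finrank_quotient_add_finrank (LinearMap.ker T)
  rwa [(T.quotKerEquivOfSurjective hT).finrank_eq, Module.finrank_fin_fun,
    Module.finrank_fin_fun] at h1

theorem linearIndependent_row_of_mul_eq_one (H : Matrix (Fin r) (Fin n) F[X])
    (Y : Matrix (Fin n) (Fin r) F[X]) (hY : H * Y = 1) : LinearIndependent F[X] H.row := by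
  rw [← Matrix.vecMul_injective_iff]
  intro x y hxy
  have h1 := congrArg (fun v => Matrix.vecMul v Y) hxy
  simpa [Matrix.vecMul_vecMul, hY] using h1

theorem mul_eq_zero_of_isGeneratorMatrix (H : Matrix (Fin r) (Fin n) F[X])
    (G : Matrix (Fin n) (Fin k) F[X]) (C : Submodule F[X] (Fin n → F[X]))
    (hG : IsGeneratorMatrix G C) (hC : C = LinearMap.ker H.mulVecLin) : H * G = 0 := by
  have h1 : ∀ x, (H * G).mulVec x = 0 := fun x => by
    have h2 : G.mulVec x ∈ C := hG.2 ▸ ⟨x, rfl⟩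
    rw [hC] at h2
    rw [← Matrix.mulVec_mulVec]
    exact h2
  exact Matrix.ext_of_mulVec_single fun i => by rw [h1, Matrix.zero_mulVec]

/-- The columns of `1 - Y * H` lie in the code, so `1 - Y * H = G * M` for some `M`. Multiplication
by `G` gives `G * M * G = G`, and `G` is injective. -/
theorem exists_leftInverse_of_isGeneratorMatrix (H : Matrix (Fin r) (Fin n) F[X])
    (Y : Matrix (Fin n) (Fin r) F[X]) (hY : H * Y = 1) (G : Matrix (Fin n) (Fin k) F[X])
    (C : Submodule F[X] (Fin n → F[X])) (hG : IsGeneratorMatrix G C)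
    (hC : C = LinearMap.ker H.mulVecLin) : ∃ M : Matrix (Fin k) (Fin n) F[X], M * G = 1 := by
  have h1 : ∀ j, ∃ x, G.mulVec x = (1 - Y * H).mulVec (Pi.single j 1) := fun j => by
    have h2 : (1 - Y * H).mulVec (Pi.single j 1) ∈ C := by
      rw [hC, LinearMap.mem_ker, Matrix.mulVecLin_apply, Matrix.mulVec_mulVec, Matrix.mul_sub,
        Matrix.mul_one, ← Matrix.mul_assoc, hY, Matrix.one_mul, sub_self,
        Matrix.zero_mulVec]
    rw [hG.2] at h2
    exact h2
  choose x hx using h1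
  let M : Matrix (Fin k) (Fin n) F[X] := Matrix.of fun i j => x j i
  have h3 : G * M = 1 - Y * H := by
    refine Matrix.ext_of_mulVec_single fun j => ?_
    rw [← hx, ← Matrix.mulVec_mulVec]
    congr 1
    ext i
    simp [M]
  refine ⟨M, ?_⟩
  have hinj := Matrix.mulVec_injective_iff.2 hG.1
  refine Matrix.ext_of_mulVec_single fun j => hinj ?_
  rw [Matrix.mulVec_mulVec, Matrix.mulVec_mulVec, ← Matrix.mul_assoc, h3, Matrix.sub_mul,
    Matrix.mul_assoc, mul_eq_zero_of_isGeneratorMatrix H G C hG hC, Matrix.mul_zero, sub_zero,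
    Matrix.one_mul, Matrix.mul_one]

/-- The maximal minors of a generator matrix are the dual minors of a left prime parity-check
matrix, up to a common constant factor. -/
theorem exists_rowMinor_eq (h : r + k = n) (H : Matrix (Fin r) (Fin n) F[X])
    (Y : Matrix (Fin n) (Fin r) F[X]) (hY : H * Y = 1) (G : Matrix (Fin n) (Fin k) F[X])
    (C : Submodule F[X] (Fin n → F[X])) (hG : IsGeneratorMatrix G C)
    (hC : C = LinearMap.ker H.mulVecLin) :
    ∃ c : F, c ≠ 0 ∧ ∀ I : Fin k ↪o Fin n, rowMinor G I = Polynomial.C c * dualMinor h H I := by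
  obtain ⟨M, hM⟩ := exists_leftInverse_of_isGeneratorMatrix H Y hY G C hG hC
  have hG0 := mul_eq_zero_of_isGeneratorMatrix H G C hG hC
  obtain ⟨c, hc, hc'⟩ := Polynomial.isUnit_iff.1 (isUnit_det_fromCols h H Y G M hY hG0 hM)
  exact ⟨c, hc.ne_zero, fun I => by rw [hc', mul_comm, dualMinor_mul_det h H Y G hY hG0, rowMinor]⟩

/-- A non-catastrophic code has a parity-check matrix with a right inverse. -/
theorem exists_parityCheck (h : r + k = n) {δ : ℕ} (C : ConvolutionalCode F n k δ)
    (hC : C.IsNoncatastrophic) :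
    ∃ (H : Matrix (Fin r) (Fin n) F[X]) (Y : Matrix (Fin n) (Fin r) F[X]), H * Y = 1 ∧
      C.carrier = LinearMap.ker H.mulVecLin := by
  have hG := C.generatorMatrix_spec
  set G := C.generatorMatrix
  obtain ⟨M, hM⟩ := exists_leftInverse_of_isRightPrime G (hC G hG)
  have hMG : ∀ x, M.mulVec (G.mulVec x) = x := fun x => by
    rw [Matrix.mulVec_mulVec, hM, Matrix.one_mulVec]
  have hrank : Module.finrank F[X] (LinearMap.ker M.mulVecLin) = r := by
    have h1 := finrank_ker_of_surjective M.mulVecLin fun x => ⟨G.mulVec x, hMG x⟩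
    omega
  let b : Module.Basis (Fin r) F[X] (LinearMap.ker M.mulVecLin) :=
    Module.finBasisOfFinrankEq F[X] _ hrank
  -- `Q` is the projection onto `ker M` along the image of `G`. Its coordinates in a basis of `ker
  -- M` form the parity-check matrix, and the inclusion of `ker M` gives the right inverse.
  let Q : (Fin n → F[X]) →ₗ[F[X]] (Fin n → F[X]) := LinearMap.id - G.mulVecLin ∘ₗ M.mulVecLin
  have hP : ∀ v, Q v ∈ LinearMap.ker M.mulVecLin := by
    intro v
    simp only [Q, LinearMap.mem_ker, map_sub, LinearMap.sub_apply, LinearMap.id_apply,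
      LinearMap.comp_apply, Matrix.mulVecLin_apply, hMG, sub_self]
  let P : (Fin n → F[X]) →ₗ[F[X]] LinearMap.ker M.mulVecLin := LinearMap.codRestrict _ _ hP
  let T : (Fin n → F[X]) →ₗ[F[X]] (Fin r → F[X]) := b.equivFun.toLinearMap ∘ₗ P
  let T' : (Fin r → F[X]) →ₗ[F[X]] (Fin n → F[X]) :=
    (LinearMap.ker M.mulVecLin).subtype ∘ₗ b.equivFun.symm.toLinearMap
  have hTT : T ∘ₗ T' = LinearMap.id := by
    refine LinearMap.ext fun x => ?_
    have h1 : P (b.equivFun.symm x) = b.equivFun.symm x := by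
      refine Subtype.ext ?_
      have h2 : M.mulVec (b.equivFun.symm x : Fin n → F[X]) = 0 := (b.equivFun.symm x).2
      change (b.equivFun.symm x : Fin n → F[X]) - G.mulVec (M.mulVec _) = _
      rw [h2, Matrix.mulVec_zero, sub_zero]
    change b.equivFun (P (b.equivFun.symm x)) = x
    rw [h1, LinearEquiv.apply_symm_apply]
  refine ⟨LinearMap.toMatrix' T, LinearMap.toMatrix' T', ?_, ?_⟩
  · rw [← LinearMap.toMatrix'_comp, hTT, LinearMap.toMatrix'_id]
  · have h1 : (LinearMap.toMatrix' T).mulVecLin = T := Matrix.toLin'_toMatrix' T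
    rw [h1, hG.2]
    ext v
    constructor
    · rintro ⟨x, rfl⟩
      rw [LinearMap.mem_ker]
      change b.equivFun (P (G.mulVec x)) = 0
      rw [LinearEquiv.map_eq_zero_iff]
      refine Subtype.ext ?_
      change G.mulVec x - G.mulVec (M.mulVec _) = 0
      rw [hMG, sub_self]
    · intro hv
      have h2 : P v = 0 := b.equivFun.map_eq_zero_iff.1 hv
      have h3 : v - G.mulVec (M.mulVec v) = 0 := congrArg Subtype.val h2
      exact ⟨M.mulVec v, (sub_eq_zero.1 h3).symm⟩

theorem maxMinorDegree_eq (h : r + k = n) (H : Matrix (Fin r) (Fin n) F[X])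
    (Y : Matrix (Fin n) (Fin r) F[X]) (hY : H * Y = 1) (G : Matrix (Fin n) (Fin k) F[X])
    (C : Submodule F[X] (Fin n → F[X])) (hG : IsGeneratorMatrix G C)
    (hC : C = LinearMap.ker H.mulVecLin) :
    maxMinorDegree G
      = Finset.univ.sup fun I : Fin k ↪o Fin n => (dualMinor h H I).natDegree := by
  obtain ⟨c, hc, hI⟩ := exists_rowMinor_eq h H Y hY G C hG hC
  refine Finset.sup_congr rfl fun I _ => ?_
  rw [hI, natDegree_C_mul hc]

/-- The code with a given parity-check matrix. -/
def ofParityCheck (h : r + k = n) (H : Matrix (Fin r) (Fin n) F[X])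
    (Y : Matrix (Fin n) (Fin r) F[X]) (hY : H * Y = 1) (δ : ℕ)
    (hδ : (Finset.univ.sup fun I : Fin k ↪o Fin n => (dualMinor h H I).natDegree) = δ) :
    NoncatastrophicCode F n k δ :=
  ⟨{ carrier := LinearMap.ker H.mulVecLin
     free := inferInstance
     rank_eq := by
      have h1 := finrank_ker_of_surjective H.mulVecLin fun x =>
        ⟨Y.mulVec x, by rw [Matrix.mulVecLin_apply, Matrix.mulVec_mulVec, hY, Matrix.one_mulVec]⟩
      omega
     degree_eq := fun G hG => by rw [maxMinorDegree_eq h H Y hY G _ hG rfl, hδ] },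
   fun G hG => by
    obtain ⟨M, hM⟩ := exists_leftInverse_of_isGeneratorMatrix H Y hY G _ hG rfl
    exact isRightPrime_of_mul_eq_one G M hM⟩

theorem ConvolutionalCode.sup_natDegree_dualMinor (h : r + k = n) {δ : ℕ}
    (C : ConvolutionalCode F n k δ) (H : Matrix (Fin r) (Fin n) F[X])
    (Y : Matrix (Fin n) (Fin r) F[X]) (hY : H * Y = 1)
    (hC : C.carrier = LinearMap.ker H.mulVecLin) :
    (Finset.univ.sup fun I : Fin k ↪o Fin n => (dualMinor h H I).natDegree) = δ := by
  rw [← maxMinorDegree_eq h H Y hY _ _ C.generatorMatrix_spec hC,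
    C.degree_eq _ C.generatorMatrix_spec]

end ParityCheck

/-! ### The Zariski topology in Plücker coordinates -/

section Topology

variable {F : Type*} [Field F] {n k δ : ℕ}

theorem eval_smul_of_isHomogeneous {σ R : Type*} [CommRing R] {f : MvPolynomial σ R} {d : ℕ}
    (hf : f.IsHomogeneous d) (c : R) (v : σ → R) :
    MvPolynomial.eval (c • v) f = c ^ d * MvPolynomial.eval v f := by
  rw [MvPolynomial.eval_eq, MvPolynomial.eval_eq, Finset.mul_sum]
  refine Finset.sum_congr rfl fun m hm => ?_
  have h1 : ∑ i ∈ m.support, m i = d := by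
    have h2 := hf (MvPolynomial.mem_support_iff.1 hm)
    rwa [Finsupp.weight_apply, Finsupp.sum, Finset.sum_congr rfl fun i _ => by
      rw [Pi.one_apply, smul_eq_mul, mul_one]] at h2
  simp only [Pi.smul_apply, smul_eq_mul, mul_pow, Finset.prod_mul_distrib,
    Finset.prod_pow_eq_pow_sum, h1]
  ring

theorem eval_rep_ne_zero_iff {d : ℕ} {f : MvPolynomial (PluckerIndex n k δ) F}
    (hf : f.IsHomogeneous d) (C : NoncatastrophicCode F n k δ) :
    MvPolynomial.eval (plucker C).rep f ≠ 0 ↔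
      MvPolynomial.eval (pluckerVector δ C.1.generatorMatrix) f ≠ 0 := by
  obtain ⟨a, ha⟩ := Projectivization.exists_smul_eq_mk_rep F
    (pluckerVector δ C.1.generatorMatrix) (pluckerVector_ne_zero C)
  rw [plucker, ← ha, Units.smul_def, eval_smul_of_isHomogeneous hf]
  simp

theorem isOpen_setOf_eval_ne_zero {d : ℕ} {f : MvPolynomial (PluckerIndex n k δ) F}
    (hf : f.IsHomogeneous d) :
    IsOpen {C : NoncatastrophicCode F n k δ |
      MvPolynomial.eval (pluckerVector δ C.1.generatorMatrix) f ≠ 0} := by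
  refine ⟨{p | MvPolynomial.eval p.rep f ≠ 0},
    TopologicalSpace.isOpen_generateFrom_of_mem ⟨d, f, hf, rfl⟩, ?_⟩
  ext C
  exact eval_rep_ne_zero_iff hf C

theorem exists_isHomogeneous_of_isOpen {U : Set (NoncatastrophicCode F n k δ)} (hU : IsOpen U)
    {C : NoncatastrophicCode F n k δ} (hC : C ∈ U) :
    ∃ (d : ℕ) (f : MvPolynomial (PluckerIndex n k δ) F), f.IsHomogeneous d ∧
      MvPolynomial.eval (pluckerVector δ C.1.generatorMatrix) f ≠ 0 ∧
      ∀ C' : NoncatastrophicCode F n k δ,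
        MvPolynomial.eval (pluckerVector δ C'.1.generatorMatrix) f ≠ 0 → C' ∈ U := by
  obtain ⟨V, hV, rfl⟩ := hU
  -- The generating sets are a basis of the topology: their intersections correspond to products of
  -- forms.
  have key : ∀ p ∈ V, ∃ (d : ℕ) (f : MvPolynomial (PluckerIndex n k δ) F), f.IsHomogeneous d ∧
      MvPolynomial.eval p.rep f ≠ 0 ∧ ∀ p', MvPolynomial.eval p'.rep f ≠ 0 → p' ∈ V := by
    clear hC
    induction hV with
    | basic s hs =>
      obtain ⟨d, f, hf, rfl⟩ := hs
      exact fun p hp => ⟨d, f, hf, hp, fun _ h => h⟩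
    | univ => exact fun p _ => ⟨0, 1, MvPolynomial.isHomogeneous_one _ _, by simp, fun _ _ => trivial⟩
    | inter s t _ _ ihs iht =>
      intro p hp
      obtain ⟨d, f, hf, hp1, hs⟩ := ihs p hp.1
      obtain ⟨e, g, hg, hp2, ht⟩ := iht p hp.2
      refine ⟨d + e, f * g, hf.mul hg, by simpa using ⟨hp1, hp2⟩, fun p' hp' => ?_⟩
      rw [map_mul] at hp'
      exact ⟨hs _ (left_ne_zero_of_mul hp'), ht _ (right_ne_zero_of_mul hp')⟩
    | sUnion S _ ih =>
      rintro p ⟨s, hs, hps⟩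
      obtain ⟨d, f, hf, hp1, h1⟩ := ih s hs p hps
      exact ⟨d, f, hf, hp1, fun p' hp' => ⟨s, hs, h1 p' hp'⟩⟩
  obtain ⟨d, f, hf, h1, h2⟩ := key _ hC
  exact ⟨d, f, hf, (eval_rep_ne_zero_iff hf C).1 h1, fun C' hC' =>
    h2 _ ((eval_rep_ne_zero_iff hf C').2 hC')⟩

end Topology

/-! ### Dual words with prescribed support -/

/-- The dual of `C` contains no nonzero vector of polynomials all of whose nonzero coefficients
have their position in `S`; the position `(j, e)` is that of `z^e` in the `j`-th component. -/
def TrivialDual {F : Type*} [Field F] {n : ℕ} (C : Submodule F[X] (Fin n → F[X]))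
    (S : Finset (Fin n × ℕ)) : Prop :=
  ∀ w : Fin n → F[X], (∀ v ∈ C, w ⬝ᵥ v = 0) → (∀ j e, (j, e) ∉ S → (w j).coeff e = 0) → w = 0

/-- Sorts the row indices, so that a minor with arbitrary rows becomes a signed Plücker coordinate;
the sign does not depend on `G`. With a repeated index `ε` is `0` and `I'` is arbitrary. -/
theorem exists_det_submatrix_eq (R : Type*) [CommRing R] {n k : ℕ} (hkn : k ≤ n)
    (I : Fin k → Fin n) :
    ∃ (ε : ℤ) (I' : Fin k ↪o Fin n), ∀ G : Matrix (Fin n) (Fin k) R,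
      (G.submatrix I id).det = ε * (G.submatrix I' id).det := by
  by_cases hI : Function.Injective I
  · have hs : StrictMono (I ∘ Tuple.sort I) :=
      (Tuple.monotone_sort I).strictMono_of_injective (hI.comp (Tuple.sort I).injective)
    refine ⟨Equiv.Perm.sign (Tuple.sort I), OrderEmbedding.ofStrictMono _ hs, fun G => ?_⟩
    have h1 : G.submatrix (OrderEmbedding.ofStrictMono _ hs) id
        = (G.submatrix I id).submatrix (Tuple.sort I) id := rfl
    rw [h1, Matrix.det_permute, ← mul_assoc, ← Int.cast_mul, ← Units.val_mul, Int.units_mul_self]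
    simp
  · refine ⟨0, Fin.castLEOrderEmb hkn, fun G => ?_⟩
    obtain ⟨a, b, hab, hne⟩ : ∃ a b, I a = I b ∧ a ≠ b := by
      simpa [Function.Injective] using hI
    rw [Matrix.det_zero_of_row_eq hne (by ext j; simp [hab])]
    simp

theorem sum_mul_det_update {R : Type*} [CommRing R] {n k : ℕ} (G : Matrix (Fin n) (Fin k) R)
    (w : Fin n → R) (I : Fin k → Fin n) (i : Fin k) :
    ∑ j, w j * (G.submatrix (Function.update I i j) id).det
      = (G.submatrix I id).transpose.cramer (Matrix.vecMul w G) i := by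
  have h1 : Matrix.vecMul w G = ∑ j, w j • G j := by
    ext x
    simp [Matrix.vecMul, dotProduct]
  rw [h1, map_sum, Finset.sum_apply]
  refine Finset.sum_congr rfl fun j _ => ?_
  rw [map_smul, Pi.smul_apply, Matrix.cramer_transpose_apply, smul_eq_mul]
  congr 2
  ext a b
  by_cases ha : a = i
  · subst ha; simp
  · simp [ha]

/-- Cramer's rule turns `w G = 0` into equations whose coefficients are the minors of `G` rather
than its entries. One nonzero minor suffices to recover `w G = 0`. -/
theorem vecMul_eq_zero_iff {F : Type*} [Field F] {n k : ℕ} (G : Matrix (Fin n) (Fin k) F[X])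
    (hG : ∃ I : Fin k ↪o Fin n, rowMinor G I ≠ 0) (w : Fin n → F[X]) :
    Matrix.vecMul w G = 0 ↔ ∀ (I : Fin k → Fin n) (i : Fin k),
      ∑ j, w j * (G.submatrix (Function.update I i j) id).det = 0 := by
  constructor
  · intro h I i
    rw [sum_mul_det_update, h, map_zero, Pi.zero_apply]
  · intro h
    obtain ⟨I, hI⟩ := hG
    have h1 : (G.submatrix I id).transpose.cramer (Matrix.vecMul w G) = 0 := by
      ext1 i
      rw [← sum_mul_det_update, h, Pi.zero_apply]
    have h2 := (G.submatrix I id).transpose.mulVec_cramer (Matrix.vecMul w G)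
    rw [h1, Matrix.mulVec_zero, Matrix.det_transpose] at h2
    exact (smul_eq_zero.1 h2.symm).resolve_left hI

theorem forall_mem_dotProduct_eq_zero_iff {F : Type*} [Field F] {n k : ℕ}
    (G : Matrix (Fin n) (Fin k) F[X]) (C : Submodule F[X] (Fin n → F[X]))
    (hG : IsGeneratorMatrix G C) (w : Fin n → F[X]) :
    (∀ v ∈ C, w ⬝ᵥ v = 0) ↔ Matrix.vecMul w G = 0 := by
  rw [hG.2]
  constructor
  · intro h
    ext1 j
    have h1 := h (G.mulVec (Pi.single j 1)) ⟨_, rfl⟩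
    rwa [Matrix.dotProduct_mulVec, dotProduct_single, mul_one] at h1
  · rintro h _ ⟨x, rfl⟩
    rw [Matrix.mulVecLin_apply, Matrix.dotProduct_mulVec, h, zero_dotProduct]

theorem exists_rowMinor_ne_zero {F : Type*} [Field F] {n k δ : ℕ} (C : NoncatastrophicCode F n k δ) :
    ∃ I : Fin k ↪o Fin n, rowMinor C.1.generatorMatrix I ≠ 0 := by
  by_contra! h
  apply pluckerVector_ne_zero C
  ext q
  simp [pluckerVector, h]

/-- The vector of polynomials with the coefficient `c p` at each position `p`. -/
def wordOfCoeffs {F : Type*} [Field F] {n : ℕ} (S : Finset (Fin n × ℕ)) (c : S → F) :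
    Fin n → F[X] :=
  fun j => ∑ p : S, if p.1.1 = j then monomial p.1.2 (c p) else 0

theorem coeff_wordOfCoeffs {F : Type*} [Field F] {n : ℕ} (S : Finset (Fin n × ℕ)) (c : S → F)
    (j : Fin n) (e : ℕ) :
    (wordOfCoeffs S c j).coeff e = if h : (j, e) ∈ S then c ⟨(j, e), h⟩ else 0 := by
  rw [wordOfCoeffs, finsetSum_coeff]
  have h1 : ∀ p : S, (if p.1.1 = j then monomial p.1.2 (c p) else 0 : F[X]).coeff e
      = if p.1 = (j, e) then c p else 0 := fun p => by
    by_cases h2 : p.1.1 = j <;> simp [h2, coeff_monomial, Prod.ext_iff]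
  simp only [h1]
  split_ifs with h
  · rw [Finset.sum_eq_single ⟨(j, e), h⟩]
    · simp
    · intro p _ hp
      rw [if_neg]
      exact fun h2 => hp (Subtype.ext h2)
    · simp
  · refine Finset.sum_eq_zero fun p _ => ?_
    rw [if_neg]
    exact fun h2 => h (h2 ▸ p.2)

theorem exists_eq_wordOfCoeffs {F : Type*} [Field F] {n : ℕ} (S : Finset (Fin n × ℕ))
    (w : Fin n → F[X]) (hw : ∀ j e, (j, e) ∉ S → (w j).coeff e = 0) :
    ∃ c : S → F, w = wordOfCoeffs S c := by
  refine ⟨fun p => (w p.1.1).coeff p.1.2, ?_⟩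
  ext j e
  rw [coeff_wordOfCoeffs]
  split_ifs with h
  · rfl
  · exact hw j e h

theorem isOpen_setOf_trivialDual {F : Type*} [Field F] {n k δ : ℕ} (hkn : k ≤ n)
    (S : Finset (Fin n × ℕ)) :
    IsOpen {C : NoncatastrophicCode F n k δ | TrivialDual C.1.carrier S} := by
  choose ε I' hI' using exists_det_submatrix_eq F[X] hkn (n := n) (k := k)
  -- The index `a = (I, i, s)` stands for the coefficient of `z^s` in the Cramer equation for `I`
  -- and `i`; `A a p` is the factor of the unknown coefficient at position `p`. Exponents outside
  -- `0, …, δ` contribute zero, since the minors have degree at most `δ`.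
  let A : (Fin k → Fin n) × Fin k × ℕ → S → MvPolynomial (PluckerIndex n k δ) F := fun a p =>
    if h : p.1.2 ≤ a.2.2 ∧ a.2.2 - p.1.2 < δ + 1 then
      MvPolynomial.C (ε (Function.update a.1 a.2.1 p.1.1) : F) *
        MvPolynomial.X (I' (Function.update a.1 a.2.1 p.1.1), ⟨a.2.2 - p.1.2, h.2⟩)
    else 0
  have hA : ∀ a p, (A a p).IsHomogeneous 1 := by
    intro a p
    by_cases h : p.1.2 ≤ a.2.2 ∧ a.2.2 - p.1.2 < δ + 1
    · simp only [A, dif_pos h]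
      have h1 := (MvPolynomial.isHomogeneous_C (PluckerIndex n k δ)
        (ε (Function.update a.1 a.2.1 p.1.1) : F)).mul (MvPolynomial.isHomogeneous_X F
          (I' (Function.update a.1 a.2.1 p.1.1), (⟨a.2.2 - p.1.2, h.2⟩ : Fin (δ + 1))))
      rwa [zero_add] at h1
    · simp only [A, dif_neg h]
      exact MvPolynomial.isHomogeneous_zero _ _ _
  have hval : ∀ (C : NoncatastrophicCode F n k δ) (a : (Fin k → Fin n) × Fin k × ℕ) (p : S),
      MvPolynomial.eval (pluckerVector δ C.1.generatorMatrix) (A a p)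
        = (X ^ p.1.2 * (C.1.generatorMatrix.submatrix
            (Function.update a.1 a.2.1 p.1.1) id).det).coeff a.2.2 := by
    intro C a p
    rw [hI', coeff_X_pow_mul']
    change _ = if _ then ((ε _ : F[X]) * rowMinor C.1.generatorMatrix _).coeff _ else 0
    have hdeg : (rowMinor C.1.generatorMatrix (I' (Function.update a.1 a.2.1 p.1.1))).natDegree
        ≤ δ :=
      (Finset.le_sup (f := fun I => (rowMinor C.1.generatorMatrix I).natDegree)
        (Finset.mem_univ _)).trans_eq (C.1.degree_eq _ C.1.generatorMatrix_spec)
    have hcast : ∀ m : ℤ, (m : F[X]) = Polynomial.C (m : F) := fun m => by simp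
    rw [hcast, coeff_C_mul]
    by_cases h1 : p.1.2 ≤ a.2.2
    · by_cases h2 : a.2.2 - p.1.2 < δ + 1
      · simp only [A]
        rw [dif_pos ⟨h1, h2⟩, if_pos h1]
        simp [pluckerVector]
      · simp only [A]
        rw [dif_neg fun h => h2 h.2, if_pos h1, coeff_eq_zero_of_natDegree_lt (by omega), mul_zero,
          map_zero]
    · simp only [A]
      rw [dif_neg fun h => h1 h.1, if_neg h1, map_zero]
  have hsum : ∀ (C : NoncatastrophicCode F n k δ) (a : (Fin k → Fin n) × Fin k × ℕ) (c : S → F),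
      (fun p => MvPolynomial.eval (pluckerVector δ C.1.generatorMatrix) (A a p)) ⬝ᵥ c
        = (∑ j, wordOfCoeffs S c j * (C.1.generatorMatrix.submatrix
            (Function.update a.1 a.2.1 j) id).det).coeff a.2.2 := by
    intro C a c
    simp only [wordOfCoeffs, Finset.sum_mul, dotProduct, hval]
    rw [Finset.sum_comm, finsetSum_coeff]
    refine Finset.sum_congr rfl fun p _ => ?_
    simp only [ite_mul, zero_mul]
    rw [Finset.sum_ite_eq Finset.univ p.1.1, if_pos (Finset.mem_univ _), ← C_mul_X_pow_eq_monomial,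
      mul_assoc, coeff_C_mul, mul_comm]
  have hiff : ∀ C : NoncatastrophicCode F n k δ, TrivialDual C.1.carrier S ↔ ∀ c : S → F,
      (∀ a, (fun p => MvPolynomial.eval (pluckerVector δ C.1.generatorMatrix) (A a p)) ⬝ᵥ c = 0) →
        c = 0 := by
    intro C
    have hc : ∀ c : S → F, (∀ v ∈ C.1.carrier, wordOfCoeffs S c ⬝ᵥ v = 0) ↔
        ∀ a, (fun p => MvPolynomial.eval (pluckerVector δ C.1.generatorMatrix) (A a p)) ⬝ᵥ c
          = 0 := by
      intro c
      rw [forall_mem_dotProduct_eq_zero_iff _ _ C.1.generatorMatrix_spec,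
        vecMul_eq_zero_iff _ (exists_rowMinor_ne_zero C)]
      constructor
      · intro h a
        rw [hsum, h, coeff_zero]
      · intro h I i
        ext s
        rw [← hsum C (I, i, s), h, coeff_zero]
    constructor
    · intro h c hc0
      have h1 := h (wordOfCoeffs S c) ((hc c).2 hc0) fun j e hje => by
        rw [coeff_wordOfCoeffs, dif_neg hje]
      ext p
      have h2 := coeff_wordOfCoeffs S c p.1.1 p.1.2
      rw [h1, dif_pos p.2] at h2
      exact h2.symm
    · intro h w hw hS
      obtain ⟨c, rfl⟩ := exists_eq_wordOfCoeffs S w hS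
      rw [h c ((hc c).1 hw)]
      ext j e
      rw [coeff_wordOfCoeffs]
      simp
  -- Injectivity of the system means that some choice `e` of as many equations as unknowns has
  -- nonzero determinant.
  have hset : {C : NoncatastrophicCode F n k δ | TrivialDual C.1.carrier S}
      = ⋃ e : S → (Fin k → Fin n) × Fin k × ℕ, {C | MvPolynomial.eval
          (pluckerVector δ C.1.generatorMatrix) (Matrix.of fun b => A (e b)).det ≠ 0} := by
    have hdet : ∀ (C : NoncatastrophicCode F n k δ) (e : S → (Fin k → Fin n) × Fin k × ℕ),
        MvPolynomial.eval (pluckerVector δ C.1.generatorMatrix) (Matrix.of fun b => A (e b)).det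
        = (Matrix.of fun b p =>
            MvPolynomial.eval (pluckerVector δ C.1.generatorMatrix) (A (e b) p)).det := by
      intro C e
      rw [RingHom.map_det]
      rfl
    ext C
    simp only [Set.mem_ofPred_eq, Set.mem_iUnion, hiff, hdet]
    constructor
    · intro h
      exact exists_det_ne_zero _ h
    · rintro ⟨e, he⟩ c hc
      exact eq_zero_of_det_ne_zero
        (fun a p => MvPolynomial.eval (pluckerVector δ C.1.generatorMatrix) (A a p)) e he c hc
  rw [hset]
  refine isOpen_iUnion fun e => isOpen_setOf_eval_ne_zero (isHomogeneous_det _ fun i j => hA _ _)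

/-! ### Coprime families of polynomials of bounded degree -/

/-- The coefficients of `1, …, z^(2 δ)` in the products of the `p i` with `1, …, z^δ`. -/
def shiftCoeff {R ι : Type*} [CommRing R] (p : ι → R[X]) (δ : ℕ) :
    ι × Fin (δ + 1) → Fin (2 * δ + 1) → R :=
  fun a s => (X ^ a.2.val * p a.1).coeff s.val

/-- The minor of the matrix of `shiftCoeff` formed by the rows `e`. -/
def shiftMinor {R ι : Type*} [CommRing R] (p : ι → R[X]) (δ : ℕ)
    (e : Fin (2 * δ + 1) → ι × Fin (δ + 1)) : R :=
  (Matrix.of fun b => shiftCoeff p δ (e b)).det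

theorem shiftMinor_map {R S ι : Type*} [CommRing R] [CommRing S] (φ : R →+* S) (p : ι → R[X])
    (δ : ℕ) (e : Fin (2 * δ + 1) → ι × Fin (δ + 1)) :
    shiftMinor (fun i => (p i).map φ) δ e = φ (shiftMinor p δ e) := by
  rw [shiftMinor, shiftMinor, RingHom.map_det]
  congr 1
  ext b s
  simp [shiftCoeff, coeff_X_pow_mul', apply_ite φ]

section ShiftMinor

variable {F ι : Type*} [Field F] {δ : ℕ}

/-- By duality, let a functional `T` on polynomials of degree at most `2 δ` kill all `q * p i` with
`deg q ≤ δ`. It must vanish on every `z^s`, because each `z^s` is a combination of the `p i` with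
multipliers of degree at most `δ`. -/
theorem exists_shiftMinor_ne_zero [Fintype ι] (p : ι → F[X])
    (hspan : Ideal.span (Set.range p) = ⊤) (hdeg : ∀ i, (p i).natDegree ≤ δ) {i₀ : ι}
    (hi₀ : (p i₀).coeff δ ≠ 0) : ∃ e, shiftMinor p δ e ≠ 0 := by
  refine exists_det_ne_zero (shiftCoeff p δ) fun c hc => ?_
  let T : F[X] →ₗ[F] F := ∑ s : Fin (2 * δ + 1), c s • lcoeff F s.val
  have hT : ∀ q, T q = ∑ s : Fin (2 * δ + 1), c s * q.coeff s.val := fun q => by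
    simp [T, LinearMap.sum_apply]
  have h1 : ∀ (q : F[X]) (i : ι), q.natDegree ≤ δ → T (q * p i) = 0 := by
    intro q i hq
    rw [q.as_sum_range' (δ + 1) (Nat.lt_succ_of_le hq), Finset.sum_mul, map_sum]
    refine Finset.sum_eq_zero fun j hj => ?_
    rw [← C_mul_X_pow_eq_monomial, mul_assoc, ← smul_eq_C_mul, map_smul]
    have h2 := hc (i, ⟨j, Finset.mem_range.1 hj⟩)
    rw [dotProduct_comm] at h2
    rw [hT]
    exact smul_eq_zero_of_right _ h2
  have hp0 : p i₀ ≠ 0 := fun h => hi₀ (by rw [h, coeff_zero])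
  have hdeg0 : (p i₀).natDegree = δ := le_antisymm (hdeg i₀) (le_natDegree_of_ne_zero hi₀)
  obtain ⟨a, ha⟩ := Ideal.mem_span_range_iff_exists_fun.1
    (hspan ▸ Submodule.mem_top : (1 : F[X]) ∈ Ideal.span (Set.range p))
  ext s
  have hr : ∀ i, (X ^ s.val * a i % p i₀).natDegree ≤ δ := fun i =>
    (natDegree_le_natDegree (degree_mod_lt _ hp0).le).trans_eq hdeg0
  -- Multiply the Bézout relation by `z^s` and reduce every multiplier modulo `p i₀`, which has
  -- degree exactly `δ`; the quotients are collected in the multiplier of `p i₀`.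
  have h3 : (X : F[X]) ^ s.val = (∑ i, X ^ s.val * a i / p i₀ * p i) * p i₀
      + ∑ i, X ^ s.val * a i % p i₀ * p i := by
    rw [Finset.sum_mul, ← Finset.sum_add_distrib]
    conv_lhs => rw [← mul_one (X ^ s.val), ← ha, Finset.mul_sum]
    refine Finset.sum_congr rfl fun i _ => ?_
    conv_lhs => rw [← mul_assoc, ← EuclideanDomain.div_add_mod (X ^ s.val * a i) (p i₀)]
    ring
  -- All other terms of `h3` have degree at most `2 δ`, which bounds the remaining multiplier.
  have h4 : (∑ i, X ^ s.val * a i / p i₀ * p i).natDegree ≤ δ := by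
    by_cases hQ : ∑ i, X ^ s.val * a i / p i₀ * p i = 0
    · rw [hQ, natDegree_zero]
      exact Nat.zero_le _
    · have h5 : ((∑ i, X ^ s.val * a i / p i₀ * p i) * p i₀).natDegree ≤ δ + δ := by
        rw [← sub_eq_of_eq_add h3]
        refine (natDegree_sub_le _ _).trans (max_le ?_ ?_)
        · rw [natDegree_X_pow]
          omega
        · exact natDegree_sum_le_of_forall_le _ _ fun i _ => natDegree_mul_le_of_le (hr i) (hdeg i)
      rw [natDegree_mul hQ hp0, hdeg0] at h5
      omega
  have h6 : T (X ^ s.val) = 0 := by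
    rw [h3, map_add, map_sum, h1 _ _ h4, zero_add]
    exact Finset.sum_eq_zero fun i _ => h1 _ _ (hr i)
  rw [hT, Finset.sum_eq_single s] at h6
  · simpa using h6
  · intro t _ hts
    rw [coeff_X_pow, if_neg (fun h => hts (Fin.ext h)), mul_zero]
  · simp

theorem span_eq_top_of_shiftMinor_ne_zero (p : ι → F[X]) (hdeg : ∀ i, (p i).natDegree ≤ δ)
    {e : Fin (2 * δ + 1) → ι × Fin (δ + 1)} (he : shiftMinor p δ e ≠ 0) :
    Ideal.span (Set.range p) = ⊤ := by
  have hu : IsUnit (Matrix.of fun b => shiftCoeff p δ (e b)) :=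
    (Matrix.isUnit_iff_isUnit_det _).2 (isUnit_iff_ne_zero.2 he)
  obtain ⟨x, hx⟩ := Matrix.vecMul_surjective_iff_isUnit.2 hu (Pi.single 0 1)
  rw [Ideal.eq_top_iff_one]
  have h1 : (1 : F[X]) = ∑ b, Polynomial.C (x b) * X ^ (e b).2.val * p (e b).1 := by
    ext s
    rw [finsetSum_coeff]
    by_cases hs : s < 2 * δ + 1
    · have h2 := congrFun hx ⟨s, hs⟩
      rw [Pi.single_apply] at h2
      simp only [Matrix.vecMul, dotProduct, Matrix.of_apply, shiftCoeff] at h2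
      simp only [mul_assoc, coeff_C_mul]
      rw [h2, coeff_one]
      simp [Fin.ext_iff]
    · rw [coeff_one, if_neg (by omega)]
      refine (Finset.sum_eq_zero fun b _ => ?_).symm
      rw [mul_assoc, coeff_C_mul, coeff_eq_zero_of_natDegree_lt, mul_zero]
      have h3 := natDegree_mul_le_of_le (natDegree_X_pow_le (R := F) (e b).2.val) (hdeg (e b).1)
      have h4 := (e b).2.isLt
      omega
  rw [h1]
  exact Ideal.sum_mem _ fun b _ => Ideal.mul_mem_left _ _ (Ideal.subset_span ⟨_, rfl⟩)

/-- Only the `z^δ` coefficients can reach the last column, that of `z^(2 δ)`, through the shift by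
`z^δ`. -/
theorem exists_coeff_ne_zero_of_shiftMinor_ne_zero (p : ι → F[X])
    (hdeg : ∀ i, (p i).natDegree ≤ δ)
    {e : Fin (2 * δ + 1) → ι × Fin (δ + 1)} (he : shiftMinor p δ e ≠ 0) :
    ∃ i, (p i).coeff δ ≠ 0 := by
  by_contra! h
  refine he (Matrix.det_eq_zero_of_column_eq_zero (Fin.last (2 * δ)) fun b => ?_)
  rw [Matrix.of_apply, shiftCoeff, coeff_X_pow_mul', Fin.val_last]
  split_ifs with h1
  · have h2 := (e b).2.isLt
    rcases Nat.lt_or_ge δ (2 * δ - (e b).2.val) with h3 | h3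
    · exact coeff_eq_zero_of_natDegree_lt ((hdeg _).trans_lt h3)
    · rw [show 2 * δ - (e b).2.val = δ by omega, h]
  · rfl

end ShiftMinor

/-! ### Dual minors of matrices with bounded row degrees -/

section RowDegrees

variable {R : Type*} [CommRing R] {r k n : ℕ} (h : r + k = n)

theorem natDegree_dualMinor_le (H : Matrix (Fin r) (Fin n) R[X]) (d : Fin r → ℕ)
    (hd : ∀ i j, (H i j).natDegree ≤ d i) (I : Fin k → Fin n) :
    (dualMinor h H I).natDegree ≤ ∑ i, d i := by
  refine (natDegree_det_le _ (Sum.elim d 0) ?_).trans_eq (by simp)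
  rintro (i | i) j
  · exact hd _ _
  · simp only [Matrix.submatrix_apply, id, Matrix.fromRows_apply_inr, Matrix.one_apply]
    split_ifs <;> simp

theorem coeff_dualMinor (H : Matrix (Fin r) (Fin n) R[X]) (d : Fin r → ℕ)
    (hd : ∀ i j, (H i j).natDegree ≤ d i) (I : Fin k → Fin n) :
    (dualMinor h H I).coeff (∑ i, d i)
      = dualMinor h (Matrix.of fun i j => (H i j).coeff (d i)) I := by
  have h1 := coeff_det_sum ((Matrix.fromRows H
    ((1 : Matrix (Fin n) (Fin n) R[X]).submatrix I id)).submatrix id (colEquiv h)) (Sum.elim d 0)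
    (by
      rintro (i | i) j
      · exact hd _ _
      · simp only [Matrix.submatrix_apply, id, Matrix.fromRows_apply_inr, Matrix.one_apply]
        split_ifs <;> simp)
  rw [Fintype.sum_sum_type] at h1
  simp only [Sum.elim_inl, Sum.elim_inr, Pi.zero_apply, Finset.sum_const_zero, add_zero] at h1
  rw [dualMinor, h1, dualMinor]
  congr 1
  ext (i | i) j
  · simp
  · simp only [Matrix.submatrix_apply, id, Matrix.fromRows_apply_inr, Matrix.one_apply,
      Matrix.of_apply, Sum.elim_inr, Pi.zero_apply]
    split_ifs <;> simp

variable {F : Type*} [Field F] {δ : ℕ}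

/-- The dual minors indexed by the increasing sequences. -/
def dualMinors (H : Matrix (Fin r) (Fin n) R[X]) (I : Fin k ↪o Fin n) : R[X] := dualMinor h H I

theorem exists_rightInverse_of_shiftMinor (H : Matrix (Fin r) (Fin n) F[X]) (d : Fin r → ℕ)
    (hd : ∀ i j, (H i j).natDegree ≤ d i) (hsum : ∑ i, d i = δ)
    (e : Fin (2 * δ + 1) → (Fin k ↪o Fin n) × Fin (δ + 1))
    (he : shiftMinor (dualMinors h H) δ e ≠ 0) :
    (∃ Y : Matrix (Fin n) (Fin r) F[X], H * Y = 1) ∧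
      (Finset.univ.sup fun I : Fin k ↪o Fin n => (dualMinor h H I).natDegree) = δ := by
  have hdeg : ∀ I, (dualMinors h H I).natDegree ≤ δ := fun I =>
    hsum ▸ natDegree_dualMinor_le h H d hd I
  have hspan := span_eq_top_of_shiftMinor_ne_zero _ hdeg he
  obtain ⟨I, hI⟩ := exists_coeff_ne_zero_of_shiftMinor_ne_zero _ hdeg he
  obtain ⟨a, ha⟩ := Ideal.mem_span_range_iff_exists_fun.1
    (hspan ▸ Submodule.mem_top : (1 : F[X]) ∈ Ideal.span (Set.range (dualMinors h H)))
  refine ⟨exists_rightInverse_of_sum_dualMinor h H (fun I : Fin k ↪o Fin n => I) a ha,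
    le_antisymm (Finset.sup_le fun I _ => hdeg I) ?_⟩
  exact (le_natDegree_of_ne_zero hI).trans (Finset.le_sup
    (f := fun I : Fin k ↪o Fin n => (dualMinor h H I).natDegree) (Finset.mem_univ I))

theorem exists_shiftMinor_dualMinors_ne_zero (C : NoncatastrophicCode F n k δ)
    (H : Matrix (Fin r) (Fin n) F[X]) (Y : Matrix (Fin n) (Fin r) F[X]) (hY : H * Y = 1)
    (hC : C.1.carrier = LinearMap.ker H.mulVecLin) :
    ∃ e, shiftMinor (dualMinors (k := k) h H) δ e ≠ 0 := by
  have hG := C.1.generatorMatrix_spec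
  obtain ⟨c, hc, hI⟩ := exists_rowMinor_eq h H Y hY _ _ hG hC
  have hsup := C.1.sup_natDegree_dualMinor h H Y hY hC
  have hdeg : ∀ I : Fin k ↪o Fin n, (dualMinors h H I).natDegree ≤ δ := fun I =>
    hsup ▸ Finset.le_sup (f := fun I : Fin k ↪o Fin n => (dualMinor h H I).natDegree)
      (Finset.mem_univ I)
  have hspan : Ideal.span (Set.range (dualMinors (k := k) h H)) = ⊤ := by
    rw [eq_top_iff, ← span_rowMinor_eq_top _ (C.2 _ hG), Ideal.span_le]
    rintro _ ⟨I, rfl⟩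
    rw [hI]
    exact Ideal.mul_mem_left _ _ (Ideal.subset_span ⟨I, rfl⟩)
  obtain ⟨I₀, hI₀⟩ := exists_rowMinor_ne_zero C
  obtain ⟨I, -, hImax⟩ := Finset.exists_mem_eq_sup (Finset.univ : Finset (Fin k ↪o Fin n))
    ⟨I₀, Finset.mem_univ _⟩ (fun I : Fin k ↪o Fin n => (dualMinor h H I).natDegree)
  rw [hsup] at hImax
  -- For `δ = 0` the maximal `natDegree` may be attained at a zero minor, so a nonzero minor is used
  -- instead.
  rcases Nat.eq_zero_or_pos δ with h0 | hpos
  · refine exists_shiftMinor_ne_zero _ hspan hdeg (i₀ := I₀) fun h1 => hI₀ ?_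
    have h2 : dualMinors h H I₀ = 0 := by
      rw [eq_C_of_natDegree_le_zero ((hdeg I₀).trans_eq h0), ← h0, h1, map_zero]
    rw [hI]
    exact mul_eq_zero_of_right _ h2
  · refine exists_shiftMinor_ne_zero _ hspan hdeg (i₀ := I) fun h1 => ?_
    have h2 : (dualMinor h H I).leadingCoeff = 0 := by
      rw [leadingCoeff, ← hImax]
      exact h1
    rw [leadingCoeff_eq_zero.1 h2, natDegree_zero] at hImax
    omega

/-- The Plücker vector of a code in terms of a parity-check matrix. -/
theorem exists_pluckerVector_eq (C : NoncatastrophicCode F n k δ)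
    (H : Matrix (Fin r) (Fin n) F[X]) (Y : Matrix (Fin n) (Fin r) F[X]) (hY : H * Y = 1)
    (hC : C.1.carrier = LinearMap.ker H.mulVecLin) :
    ∃ c : F, c ≠ 0 ∧ pluckerVector δ C.1.generatorMatrix
      = c • fun q : PluckerIndex n k δ => (dualMinors h H q.1).coeff q.2.val := by
  obtain ⟨c, hc, hI⟩ := exists_rowMinor_eq h H Y hY _ _ C.1.generatorMatrix_spec hC
  refine ⟨c, hc, funext fun q => ?_⟩
  rw [pluckerVector, hI, coeff_C_mul]
  rfl

theorem eval_pluckerVector_ne_zero_iff (C : NoncatastrophicCode F n k δ)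
    (H : Matrix (Fin r) (Fin n) F[X]) (Y : Matrix (Fin n) (Fin r) F[X]) (hY : H * Y = 1)
    (hC : C.1.carrier = LinearMap.ker H.mulVecLin) {d : ℕ}
    {f : MvPolynomial (PluckerIndex n k δ) F} (hf : f.IsHomogeneous d) :
    MvPolynomial.eval (pluckerVector δ C.1.generatorMatrix) f ≠ 0 ↔
      MvPolynomial.eval (fun q : PluckerIndex n k δ => (dualMinors h H q.1).coeff q.2.val) f
        ≠ 0 := by
  obtain ⟨c, hc, h1⟩ := exists_pluckerVector_eq h C H Y hY hC
  rw [h1, eval_smul_of_isHomogeneous hf]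
  simp [hc]

end RowDegrees

/-! ### Row reduction -/

section RowReduction

variable {F : Type*} [Field F] {r k n : ℕ} (h : r + k = n)

theorem linearIndependent_row_of_dualMinor_ne_zero (A : Matrix (Fin r) (Fin n) F)
    (I : Fin k → Fin n) (hI : dualMinor h A I ≠ 0) : LinearIndependent F A.row := by
  have h1 := Matrix.linearIndependent_rows_iff_isUnit.2
    ((Matrix.isUnit_iff_isUnit_det _).2 (isUnit_iff_ne_zero.2 hI))
  have h2 := Matrix.vecMul_injective_iff.2 h1
  rw [← Matrix.vecMul_injective_iff]
  intro x y hxy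
  have h3 : ∀ x : Fin r → F, Matrix.vecMul (Sum.elim x (0 : Fin k → F)) ((Matrix.fromRows A
      ((1 : Matrix (Fin n) (Fin n) F).submatrix I id)).submatrix id (colEquiv h))
      = fun j => Matrix.vecMul x A (colEquiv h j) := by
    intro x
    ext j
    simp [Matrix.vecMul, dotProduct]
  have h4 := @h2 (Sum.elim x 0) (Sum.elim y 0) (by
    simp only [h3]
    exact funext fun j => congrFun hxy _)
  exact funext fun i => congrFun h4 (Sum.inl i)

/-- A basis of the kernel of `A` has a nonzero maximal minor, and by `dualMinor_mul_det` this is a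
multiple of the corresponding dual minor of `A`. -/
theorem exists_dualMinor_ne_zero (A : Matrix (Fin r) (Fin n) F) (hA : LinearIndependent F A.row) :
    ∃ I : Fin k ↪o Fin n, dualMinor h A I ≠ 0 := by
  have hinj : Function.Injective A.transpose.mulVecLin := by
    intro x y hxy
    apply Matrix.vecMul_injective_iff.2 hA
    simpa [Matrix.mulVec_transpose] using hxy
  obtain ⟨T, hT⟩ := LinearMap.exists_leftInverse_of_injective _ (LinearMap.ker_eq_bot.2 hinj)
  have hY : A * (LinearMap.toMatrix' T).transpose = 1 := by
    rw [← Matrix.transpose_transpose A, ← Matrix.transpose_mul, ← Matrix.transpose_one]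
    congr 1
    have h1 := congrArg LinearMap.toMatrix' hT
    rw [LinearMap.toMatrix'_comp, LinearMap.toMatrix'_id] at h1
    rwa [← LinearMap.toMatrix'_toLin' A.transpose]
  have hrank : Module.finrank F (LinearMap.ker A.mulVecLin) = k := by
    have h1 := finrank_ker_of_surjective A.mulVecLin fun x =>
      ⟨(LinearMap.toMatrix' T).transpose.mulVec x, by
        rw [Matrix.mulVecLin_apply, Matrix.mulVec_mulVec, hY, Matrix.one_mulVec]⟩
    omega
  let b : Module.Basis (Fin k) F (LinearMap.ker A.mulVecLin) :=
    Module.finBasisOfFinrankEq F _ hrank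
  let G : Matrix (Fin n) (Fin k) F := Matrix.of fun i j => (b j : Fin n → F) i
  have hG : LinearIndependent F G.col :=
    b.linearIndependent.map' (LinearMap.ker A.mulVecLin).subtype (Submodule.ker_subtype _)
  have hAG : A * G = 0 := by
    ext i j
    exact congrFun (b j).2 i
  obtain ⟨I, hI⟩ := exists_minor_ne_zero G hG
  refine ⟨I, fun h0 => hI ?_⟩
  rw [← dualMinor_mul_det h A _ G hY hAG, h0, zero_mul]

theorem vecMul_ne_zero_of_mul_eq_one (H : Matrix (Fin r) (Fin n) F[X])
    (Y : Matrix (Fin n) (Fin r) F[X]) (hY : H * Y = 1) (u : Fin r → F[X])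
    (hu : Matrix.vecMul u H = 0) : u = 0 := by
  rw [← Matrix.vecMul_one u, ← hY, ← Matrix.vecMul_vecMul, hu, Matrix.zero_vecMul]

/-- If the rows of the matrix of highest coefficients are linearly dependent, some row can be
replaced by one of smaller degree. -/
theorem exists_row_reduction (H : Matrix (Fin r) (Fin n) F[X])
    (Y : Matrix (Fin n) (Fin r) F[X]) (hY : H * Y = 1) (d : Fin r → ℕ)
    (hd : ∀ i j, (H i j).natDegree ≤ d i)
    (hdep : ¬ LinearIndependent F (Matrix.of fun i j => (H i j).coeff (d i)).row) :
    ∃ (H' : Matrix (Fin r) (Fin n) F[X]) (Y' : Matrix (Fin n) (Fin r) F[X]) (d' : Fin r → ℕ),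
      H' * Y' = 1 ∧ LinearMap.ker H'.mulVecLin = LinearMap.ker H.mulVecLin ∧
      (∀ i j, (H' i j).natDegree ≤ d' i) ∧ ∑ i, d' i < ∑ i, d i := by
  classical
  obtain ⟨c, hc, i₁, hi₁⟩ := Fintype.not_linearIndependent_iff.1 hdep
  obtain ⟨i₀, hi₀, hmax⟩ := Finset.exists_max_image (Finset.univ.filter fun i => c i ≠ 0) d
    ⟨i₁, by simpa using hi₁⟩
  have hi₀ : c i₀ ≠ 0 := by simpa using hi₀
  have hmax : ∀ i, c i ≠ 0 → d i ≤ d i₀ := fun i hi => hmax i (by simpa using hi)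
  -- The powers of `z` align the leading terms of all rows involved at degree `d i₀`, where the
  -- dependency `c` cancels them.
  let u : Fin r → F[X] := fun i => C (c i) * X ^ (d i₀ - d i)
  have hterm : ∀ i j, (u i * H i j).natDegree ≤ d i₀ ∧
      (u i * H i j).coeff (d i₀) = c i * (H i j).coeff (d i) := by
    intro i j
    by_cases hci : c i = 0
    · simp [u, hci]
    · have h1 := hmax i hci
      simp only [u, mul_assoc]
      refine ⟨(natDegree_C_mul_le _ _).trans ((natDegree_mul_le_of_le (natDegree_X_pow_le _)
        (hd i j)).trans (by omega)), ?_⟩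
      rw [coeff_C_mul, coeff_X_pow_mul', if_pos (by omega), show d i₀ - (d i₀ - d i) = d i by omega]
  have hvdeg : ∀ j, (Matrix.vecMul u H j).natDegree ≤ d i₀ := fun j => by
    rw [Matrix.vecMul, dotProduct]
    exact natDegree_sum_le_of_forall_le _ _ fun i _ => (hterm i j).1
  have hvcoeff : ∀ j, (Matrix.vecMul u H j).coeff (d i₀) = 0 := by
    intro j
    rw [Matrix.vecMul, dotProduct, finsetSum_coeff]
    simp only [(hterm _ j).2]
    simpa using congrFun hc j
  -- Otherwise the new row would be constant with zero constant term, contradicting the independence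
  -- of the rows of `H`. Hence `d i₀ - 1` is a genuine decrease.
  have hpos : 0 < d i₀ := by
    by_contra h0
    have h0 : d i₀ = 0 := by omega
    have hu : u = 0 := by
      refine vecMul_ne_zero_of_mul_eq_one H Y hY u (funext fun j => ?_)
      rw [eq_C_of_natDegree_le_zero ((hvdeg j).trans_eq h0)]
      have := hvcoeff j
      rw [h0] at this
      simp [this]
    have h1 := congrFun hu i₀
    simp [u, hi₀] at h1
  let U : Matrix (Fin r) (Fin r) F[X] := (1 : Matrix (Fin r) (Fin r) F[X]).updateRow i₀ u
  have hdet : U.det = C (c i₀) := by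
    have h1 := Matrix.det_updateRow_sum (1 : Matrix (Fin r) (Fin r) F[X]) i₀ u
    have h2 : ∑ i, u i • (1 : Matrix (Fin r) (Fin r) F[X]) i = u := by
      ext1 j
      simp [Matrix.one_apply]
    rw [h2] at h1
    change U.det = _ at h1
    rw [h1, Matrix.det_one]
    simp [u]
  have hU : IsUnit U.det := by
    rw [hdet]
    exact isUnit_C.2 (isUnit_iff_ne_zero.2 hi₀)
  have hUH : ∀ i j, (U * H) i j = if i = i₀ then Matrix.vecMul u H j else H i j := by
    intro i j
    by_cases hi : i = i₀
    · subst hi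
      simp [U, Matrix.mul_apply, Matrix.vecMul, dotProduct]
    · simp [U, Matrix.mul_apply, hi, Matrix.one_apply]
  refine ⟨U * H, Y * U⁻¹, Function.update d i₀ (d i₀ - 1), ?_, ?_, ?_, ?_⟩
  · rw [Matrix.mul_assoc, ← Matrix.mul_assoc H, hY, Matrix.one_mul, Matrix.mul_nonsing_inv _ hU]
  · ext v
    simp only [LinearMap.mem_ker, Matrix.mulVecLin_apply]
    constructor
    · intro hv
      rw [← Matrix.mulVec_mulVec] at hv
      rw [← Matrix.one_mulVec (H.mulVec v), ← Matrix.nonsing_inv_mul _ hU, ← Matrix.mulVec_mulVec,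
        hv, Matrix.mulVec_zero]
    · intro hv
      rw [← Matrix.mulVec_mulVec, hv, Matrix.mulVec_zero]
  · intro i j
    rw [hUH]
    by_cases hi : i = i₀
    · subst hi
      rw [if_pos rfl, Function.update_self]
      rcases (hvdeg j).lt_or_eq with h1 | h1
      · omega
      · have h2 := hvcoeff j
        rw [← h1, coeff_natDegree, leadingCoeff_eq_zero] at h2
        rw [h2, natDegree_zero]
        omega
    · rw [if_neg hi, Function.update_of_ne hi]
      exact hd i j
  · refine Finset.sum_lt_sum (fun i _ => ?_) ⟨i₀, Finset.mem_univ _, ?_⟩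
    · by_cases hi : i = i₀
      · subst hi
        simp
      · rw [Function.update_of_ne hi]
    · rw [Function.update_self]
      omega

/-- The coefficient of `z^(∑ d i)` in a dual minor is the dual minor of the matrix of leading
coefficients, and one of these is nonzero. -/
theorem sum_eq_of_linearIndependent {δ : ℕ} (H : Matrix (Fin r) (Fin n) F[X]) (d : Fin r → ℕ)
    (hd : ∀ i j, (H i j).natDegree ≤ d i)
    (hli : LinearIndependent F (Matrix.of fun i j => (H i j).coeff (d i)).row)
    (hδ : (Finset.univ.sup fun I : Fin k ↪o Fin n => (dualMinor h H I).natDegree) = δ) :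
    ∑ i, d i = δ := by
  refine le_antisymm ?_ ?_
  · obtain ⟨I, hI⟩ := exists_dualMinor_ne_zero h _ hli
    rw [← coeff_dualMinor h H d hd] at hI
    rw [← hδ]
    exact (le_natDegree_of_ne_zero hI).trans (Finset.le_sup
      (f := fun I : Fin k ↪o Fin n => (dualMinor h H I).natDegree) (Finset.mem_univ I))
  · rw [← hδ]
    exact Finset.sup_le fun I _ => natDegree_dualMinor_le h H d hd I

/-- A non-catastrophic code has a row reduced parity-check matrix. -/
theorem exists_rowReduced_parityCheck (h : r + k = n) {δ : ℕ} (C : NoncatastrophicCode F n k δ) :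
    ∃ (H : Matrix (Fin r) (Fin n) F[X]) (Y : Matrix (Fin n) (Fin r) F[X]) (d : Fin r → ℕ),
      H * Y = 1 ∧ C.1.carrier = LinearMap.ker H.mulVecLin ∧
      (∀ i j, (H i j).natDegree ≤ d i) ∧ ∑ i, d i = δ ∧
      LinearIndependent F (Matrix.of fun i j => (H i j).coeff (d i)).row := by
  classical
  have hex : ∃ N, ∃ (H : Matrix (Fin r) (Fin n) F[X]) (Y : Matrix (Fin n) (Fin r) F[X])
      (d : Fin r → ℕ), H * Y = 1 ∧ C.1.carrier = LinearMap.ker H.mulVecLin ∧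
      (∀ i j, (H i j).natDegree ≤ d i) ∧ ∑ i, d i = N := by
    obtain ⟨H, Y, hY, hC⟩ := exists_parityCheck h C.1 C.2
    exact ⟨_, H, Y, rowDegree H, hY, hC, fun i j =>
      Finset.le_sup (f := fun j => (H i j).natDegree) (Finset.mem_univ j), rfl⟩
  obtain ⟨H, Y, d, hY, hC, hd, hsum⟩ := Nat.find_spec hex
  have hli : LinearIndependent F (Matrix.of fun i j => (H i j).coeff (d i)).row := by
    by_contra hdep
    obtain ⟨H', Y', d', hY', hker, hd', hlt⟩ := exists_row_reduction H Y hY d hd hdep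
    exact Nat.find_min hex (hsum ▸ hlt) ⟨H', Y', d', hY', hC.trans hker.symm, hd', rfl⟩
  exact ⟨H, Y, d, hY, hC, hd, sum_eq_of_linearIndependent h H d hd hli
    (C.1.sup_natDegree_dualMinor h H Y hY hC), hli⟩

end RowReduction

/-! ### The dual of a code in terms of a parity-check matrix -/

section Dual

variable {F : Type*} [Field F] {r n : ℕ}

/-- The columns of `1 - Y * H` lie in the kernel, so a word orthogonal to it satisfies `w = w Y H`.
-/
theorem forall_mem_ker_dotProduct_eq_zero_iff (H : Matrix (Fin r) (Fin n) F[X])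
    (Y : Matrix (Fin n) (Fin r) F[X]) (hY : H * Y = 1) (w : Fin n → F[X]) :
    (∀ v ∈ LinearMap.ker H.mulVecLin, w ⬝ᵥ v = 0) ↔ ∃ u, w = Matrix.vecMul u H := by
  constructor
  · intro hw
    refine ⟨Matrix.vecMul w Y, ?_⟩
    ext1 j
    have h1 : (1 - Y * H).mulVec (Pi.single j 1) ∈ LinearMap.ker H.mulVecLin := by
      rw [LinearMap.mem_ker, Matrix.mulVecLin_apply, Matrix.mulVec_mulVec, Matrix.mul_sub,
        Matrix.mul_one, ← Matrix.mul_assoc, hY, Matrix.one_mul, sub_self, Matrix.zero_mulVec]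
    have h2 := hw _ h1
    rw [Matrix.dotProduct_mulVec, dotProduct_single, mul_one, Matrix.vecMul_sub, Matrix.vecMul_one,
      Pi.sub_apply, sub_eq_zero] at h2
    rw [h2, Matrix.vecMul_vecMul]
  · rintro ⟨u, rfl⟩ v hv
    rw [← Matrix.dotProduct_mulVec]
    have h1 : H.mulVec v = 0 := hv
    rw [h1, dotProduct_zero]

/-- The predictable degree property: the top coefficient of `u H` is that of `u` times the
invertible-on-rows matrix `H_ν`, so no cancellation occurs. -/
theorem coeff_vecMul_sup_add (H : Matrix (Fin r) (Fin n) F[X]) (ν : ℕ)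
    (hd : ∀ i j, (H i j).natDegree ≤ ν)
    (hli : LinearIndependent F (coeffMatrix H ν).row) (u : Fin r → F[X])
    (hu : u ≠ 0) : ∃ j, (Matrix.vecMul u H j).coeff
      ((Finset.univ.sup fun i => (u i).natDegree) + ν) ≠ 0 := by
  set e := Finset.univ.sup fun i => (u i).natDegree with he
  have hle : ∀ i, (u i).natDegree ≤ e := fun i =>
    Finset.le_sup (f := fun i => (u i).natDegree) (Finset.mem_univ i)
  have hne : (fun i => (u i).coeff e) ≠ 0 := by
    intro h0
    obtain ⟨i, hi⟩ := Function.ne_iff.1 hu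
    obtain ⟨i₁, -, hi₁⟩ := Finset.exists_mem_eq_sup (Finset.univ : Finset (Fin r))
      ⟨i, Finset.mem_univ _⟩ (fun i => (u i).natDegree)
    have h1 := congrFun h0 i₁
    rw [← he] at hi₁
    simp only [hi₁, coeff_natDegree, Pi.zero_apply, leadingCoeff_eq_zero] at h1
    rw [h1, natDegree_zero] at hi₁
    have h2 := congrFun h0 i
    rw [hi₁] at h2
    apply hi
    rw [eq_C_of_natDegree_le_zero ((hle i).trans_eq hi₁)]
    simpa using h2
  by_contra! hall
  apply hne
  apply Matrix.vecMul_injective_iff.2 hli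
  ext1 j
  have h1 := hall j
  rw [Matrix.vecMul, dotProduct, finsetSum_coeff] at h1
  simp only [coeff_mul_add_eq_of_natDegree_le (hle _) (hd _ j)] at h1
  exact h1.trans (congrFun (Matrix.zero_vecMul (coeffMatrix H ν)) j).symm

theorem trivialDual_range (H : Matrix (Fin r) (Fin n) F[X]) (Y : Matrix (Fin n) (Fin r) F[X])
    (hY : H * Y = 1) (ν : ℕ) (hd : ∀ i j, (H i j).natDegree ≤ ν)
    (hli : LinearIndependent F (coeffMatrix H ν).row) :
    TrivialDual (LinearMap.ker H.mulVecLin) (Finset.univ ×ˢ Finset.range ν) := by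
  intro w hw hS
  obtain ⟨u, rfl⟩ := (forall_mem_ker_dotProduct_eq_zero_iff H Y hY w).1 hw
  by_contra hne
  obtain ⟨j, hj⟩ := coeff_vecMul_sup_add H ν hd hli u fun h0 => hne (by rw [h0, Matrix.zero_vecMul])
  exact hj (hS _ _ (by simp))

/-- The rows of `H` are nonzero dual words. Together with the degree sum `δ = r ν` this forces every
row degree to be `ν`. -/
theorem le_of_trivialDual_range (H : Matrix (Fin r) (Fin n) F[X])
    (Y : Matrix (Fin n) (Fin r) F[X]) (hY : H * Y = 1) (ν : ℕ)
    (ht : TrivialDual (LinearMap.ker H.mulVecLin) (Finset.univ ×ˢ Finset.range ν))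
    (d : Fin r → ℕ) (hd : ∀ i j, (H i j).natDegree ≤ d i) (i : Fin r) : ν ≤ d i := by
  by_contra! hlt
  have h1 := ht (Matrix.vecMul (Pi.single i 1) H)
    ((forall_mem_ker_dotProduct_eq_zero_iff H Y hY _).2 ⟨_, rfl⟩) fun j e he => by
      rw [Matrix.single_one_vecMul]
      refine coeff_eq_zero_of_natDegree_lt ((hd i j).trans_lt ?_)
      simp at he
      omega
  have h2 := congrFun (vecMul_ne_zero_of_mul_eq_one H Y hY _ h1) i
  simp at h2

/-- The positions of the coefficients of a word that do not belong to the columns `J` of the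
partial parity-check matrix. -/
def coSupport {ν L : ℕ} (J : Fin (L + 1) × Fin r ↪ Fin (ν + L + 1) × Fin n) :
    Finset (Fin n × ℕ) :=
  (Finset.univ.filter fun q => ∀ a, J a ≠ q).image fun q => (q.2, ν + L - q.1.val)

theorem mem_coSupport {ν L : ℕ} (J : Fin (L + 1) × Fin r ↪ Fin (ν + L + 1) × Fin n)
    (q : Fin (ν + L + 1) × Fin n) :
    (q.2, ν + L - q.1.val) ∈ coSupport J ↔ ∀ a, J a ≠ q := by
  simp only [coSupport, Finset.mem_image, Finset.mem_filter, Finset.mem_univ, true_and]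
  constructor
  · rintro ⟨q', hq', heq⟩
    have h1 := Prod.ext_iff.1 heq
    have h2 : q' = q := Prod.ext (Fin.ext (by have := h1.2; simp only at this; omega)) h1.1
    exact h2 ▸ hq'
  · exact fun hq => ⟨q, hq, rfl⟩

theorem notMem_coSupport_of_lt {ν L : ℕ} (J : Fin (L + 1) × Fin r ↪ Fin (ν + L + 1) × Fin n)
    (j : Fin n) (e : ℕ) (he : ν + L < e) : (j, e) ∉ coSupport J := by
  simp only [coSupport, Finset.mem_image, not_exists, not_and]
  intro q _ heq
  have h1 := (Prod.ext_iff.1 heq).2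
  simp only at h1
  omega

/-- Multiplication of polynomials written as a block Toeplitz product. Both orders are reversed:
block row `p` carries the coefficient of `z^(L - p)` in `u`, block column `q` that of `z^(ν + L -
q)` in `u H`. -/
theorem vecMul_partialParityCheck (H : Matrix (Fin r) (Fin n) F[X]) (ν L : ℕ)
    (hd : ∀ i j, (H i j).natDegree ≤ ν) (u : Fin r → F[X]) (hu : ∀ i, (u i).natDegree ≤ L)
    (q : Fin (ν + L + 1) × Fin n) :
    Matrix.vecMul (fun p : Fin (L + 1) × Fin r => (u p.2).coeff (L - p.1.val))
        (partialParityCheck (coeffMatrix H) ν L) q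
      = (Matrix.vecMul u H q.2).coeff (ν + L - q.1.val) := by
  rw [Matrix.vecMul, dotProduct, Fintype.sum_prod_type, Finset.sum_comm, Matrix.vecMul, dotProduct,
    finsetSum_coeff]
  refine Finset.sum_congr rfl fun i _ => ?_
  conv_rhs => rw [(u i).as_sum_range' (L + 1) (Nat.lt_succ_of_le (hu i)), Finset.sum_mul,
    finsetSum_coeff, ← Finset.sum_range_reflect, Finset.sum_range]
  refine Finset.sum_congr rfl fun p _ => ?_
  have hp := p.isLt
  have hq := q.1.isLt
  rw [← C_mul_X_pow_eq_monomial, mul_assoc, coeff_C_mul, coeff_X_pow_mul',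
    show L + 1 - 1 - p.val = L - p.val by omega]
  congr 1
  simp only [partialParityCheck, Matrix.of_apply, coeffMatrix, Matrix.map_apply]
  by_cases h1 : q.1.val ≤ p.val + ν
  · by_cases h2 : p.val ≤ q.1.val
    · rw [if_pos ⟨h2, h1⟩, if_pos (by omega),
        show ν + L - q.1.val - (L - p.val) = p.val + ν - q.1.val by omega]
    · rw [if_neg fun h => h2 h.1, if_pos (by omega), coeff_eq_zero_of_natDegree_lt]
      exact (hd _ _).trans_lt (by omega)
  · rw [if_neg fun h => h1 h.2, if_neg (by omega)]

/-- A dual word `u H` supported on `coSupport J` has degree at most `ν + L`, so `u` has degree at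
most `L` by predictable degree. Its coefficients then form a left kernel vector of the invertible
submatrix on `J`. -/
theorem trivialDual_coSupport (H : Matrix (Fin r) (Fin n) F[X])
    (Y : Matrix (Fin n) (Fin r) F[X]) (hY : H * Y = 1) (ν L : ℕ)
    (hd : ∀ i j, (H i j).natDegree ≤ ν) (hli : LinearIndependent F (coeffMatrix H ν).row)
    (J : Fin (L + 1) × Fin r ↪ Fin (ν + L + 1) × Fin n)
    (hJ : fullMinor (coeffMatrix H) ν L J ≠ 0) :
    TrivialDual (LinearMap.ker H.mulVecLin) (coSupport J) := by
  intro w hw hS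
  obtain ⟨u, rfl⟩ := (forall_mem_ker_dotProduct_eq_zero_iff H Y hY w).1 hw
  by_contra hne
  have hu0 : u ≠ 0 := fun h0 => hne (by rw [h0, Matrix.zero_vecMul])
  obtain ⟨j, hj⟩ := coeff_vecMul_sup_add H ν hd hli u hu0
  have hu : ∀ i, (u i).natDegree ≤ L := by
    intro i
    by_contra! hlt
    refine hj (hS _ _ (notMem_coSupport_of_lt J _ _ ?_))
    have h1 : (u i).natDegree ≤ _ :=
      Finset.le_sup (f := fun i => (u i).natDegree) (Finset.mem_univ i)
    omega
  have hx : (fun p : Fin (L + 1) × Fin r => (u p.2).coeff (L - p.1.val)) = 0 := by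
    refine Matrix.eq_zero_of_vecMul_eq_zero hJ (funext fun a => ?_)
    have h1 := vecMul_partialParityCheck H ν L hd u hu (J a)
    rw [hS _ _ fun hmem => (mem_coSupport J (J a)).1 hmem a rfl] at h1
    exact h1
  refine hu0 (funext fun i => ?_)
  ext s
  rcases Nat.lt_or_ge L s with h1 | h1
  · rw [coeff_eq_zero_of_natDegree_lt ((hu i).trans_lt h1)]
    simp
  · have h2 := congrFun hx (⟨L - s, by omega⟩, i)
    simp only [Pi.zero_apply, show L - (L - s) = s by omega] at h2
    simpa using h2

/-- A left kernel vector of the submatrix on `J`, read as the coefficients of `u`, would give a dual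
word `u H` vanishing on `J`. -/
theorem fullMinor_ne_zero_of_trivialDual (H : Matrix (Fin r) (Fin n) F[X])
    (Y : Matrix (Fin n) (Fin r) F[X]) (hY : H * Y = 1) (ν L : ℕ)
    (hd : ∀ i j, (H i j).natDegree ≤ ν)
    (J : Fin (L + 1) × Fin r ↪ Fin (ν + L + 1) × Fin n)
    (hJ : TrivialDual (LinearMap.ker H.mulVecLin) (coSupport J)) :
    fullMinor (coeffMatrix H) ν L J ≠ 0 := by
  intro h0
  obtain ⟨x, hx0, hx⟩ := Matrix.exists_vecMul_eq_zero_iff.2 h0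
  let u : Fin r → F[X] := fun i =>
    ∑ p : Fin (L + 1), monomial (L - p.val) (x (p, i))
  have hu : ∀ i, (u i).natDegree ≤ L := fun i =>
    natDegree_sum_le_of_forall_le _ _ fun p _ => (natDegree_monomial_le _).trans (by omega)
  have hcoeff : (fun p : Fin (L + 1) × Fin r => (u p.2).coeff (L - p.1.val)) = x := by
    ext ⟨p, i⟩
    simp only [u, finsetSum_coeff, coeff_monomial]
    rw [Finset.sum_eq_single p]
    · simp
    · intro p' _ hne
      rw [if_neg]
      intro h1
      have := p.isLt
      have := p'.isLt
      exact hne (Fin.ext (by omega))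
    · simp
  have hw := hJ (Matrix.vecMul u H) ((forall_mem_ker_dotProduct_eq_zero_iff H Y hY _).2 ⟨u, rfl⟩)
    fun j e he => by
      rcases Nat.lt_or_ge (ν + L) e with h1 | h1
      · refine coeff_eq_zero_of_natDegree_lt (lt_of_le_of_lt ?_ h1)
        rw [Matrix.vecMul, dotProduct]
        refine natDegree_sum_le_of_forall_le _ _ fun i _ => ?_
        exact (natDegree_mul_le_of_le (hu i) (hd i j)).trans (by omega)
      · let q : Fin (ν + L + 1) × Fin n := (⟨ν + L - e, by omega⟩, j)
        have hqe : e = ν + L - q.1.val := by simp only [q]; omega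
        have h2 : ¬ ∀ a, J a ≠ q := fun h3 => he (by
          rw [hqe]
          exact (mem_coSupport J q).2 h3)
        obtain ⟨a, ha⟩ : ∃ a, J a = q := by simpa using h2
        have h4 := vecMul_partialParityCheck H ν L hd u hu q
        rw [hcoeff, ← hqe] at h4
        rw [← h4, ← ha]
        exact congrFun hx a
  have hu0 := vecMul_ne_zero_of_mul_eq_one H Y hY u hw
  apply hx0
  rw [← hcoeff]
  ext p
  simp [hu0]

end Dual

/-! ### Complete MDP codes in terms of the dual -/

section CompleteMDP

theorem fullMinor_map {R S : Type*} [CommRing R] [CommRing S] (φ : R →+* S) {r n : ℕ}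
    (A : ℕ → Matrix (Fin r) (Fin n) R) (ν L : ℕ)
    (J : Fin (L + 1) × Fin r ↪ Fin (ν + L + 1) × Fin n) :
    fullMinor (fun i => (A i).map φ) ν L J = φ (fullMinor A ν L J) := by
  rw [fullMinor, fullMinor, RingHom.map_det]
  congr 1
  ext p q
  simp [partialParityCheck, apply_ite φ]

/-- The columns of the leftmost diagonal of blocks of the partial parity-check matrix. -/
def diagonalColumns {r n : ℕ} (hrn : r ≤ n) (ν L : ℕ) :
    Fin (L + 1) × Fin r ↪ Fin (ν + L + 1) × Fin n :=
  ⟨fun a => (⟨a.1.val, by omega⟩, Fin.castLE hrn a.2), by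
    intro a b hab
    simp only [Prod.mk.injEq, Fin.mk.injEq, Fin.castLE_inj] at hab
    exact Prod.ext (Fin.ext hab.1) hab.2⟩

theorem diagonalColumns_apply {r n : ℕ} (hrn : r ≤ n) (ν L : ℕ) (a : Fin (L + 1) × Fin r) :
    diagonalColumns hrn ν L a = (⟨a.1.val, by omega⟩, Fin.castLE hrn a.2) := rfl

theorem not_isTriviallyZero_diagonalColumns (F : Type*) [Field F] {r n : ℕ} (hrn : r ≤ n)
    (ν L : ℕ) : ¬ IsTriviallyZero F ν L (diagonalColumns (r := r) hrn ν L) := by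
  intro h0
  -- The specialization `H_ν = [1 0]`, all other coefficients zero, makes the submatrix the
  -- identity.
  let x : ℕ × Fin r × Fin n → F := fun t => if t.1 = ν ∧ t.2.1.val = t.2.2.val then 1 else 0
  have h1 := fullMinor_map (MvPolynomial.eval x) (genericCoeff F r n) ν L
    (diagonalColumns (r := r) hrn ν L)
  have h2 : (partialParityCheck (fun i => (genericCoeff F r n i).map (MvPolynomial.eval x))
      ν L).submatrix id (diagonalColumns (r := r) hrn ν L) = 1 := by
    ext ⟨p, i⟩ ⟨q, j⟩
    have hval : ∀ m, (genericCoeff F r n m).map (MvPolynomial.eval x) i (Fin.castLE hrn j)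
        = if m = ν ∧ i.val = j.val then 1 else 0 := fun m => by simp [genericCoeff, x]
    simp only [partialParityCheck, diagonalColumns_apply, Matrix.submatrix_apply, Matrix.of_apply, id,
      hval, Matrix.one_apply, Prod.mk.injEq, Fin.ext_iff]
    rw [← ite_and]
    congr 1
    simp only [eq_iff_iff]
    omega
  rw [IsTriviallyZero] at h0
  rw [h0, map_zero, fullMinor, h2, Matrix.det_one] at h1
  exact one_ne_zero h1

variable {F : Type*} [Field F] {r k n : ℕ}

/-- In the last block row the selected columns meet only the coefficient `H_ν` with `ν =
matrixDegree H` and zeros, so a row of smaller degree would be a zero row. -/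
theorem rowDegree_eq_of_fullMinor_ne_zero (hrn : r ≤ n) (H : Matrix (Fin r) (Fin n) F[X]) (L : ℕ)
    (hJ : fullMinor (coeffMatrix H) (matrixDegree H) L
      (diagonalColumns (r := r) hrn (matrixDegree H) L) ≠ 0) (i : Fin r) :
    rowDegree H i = matrixDegree H := by
  refine le_antisymm (Finset.le_sup (Finset.mem_univ i)) ?_
  by_contra! hlt
  refine hJ (Matrix.det_eq_zero_of_row_eq_zero (Fin.last L, i) fun q => ?_)
  have hq := q.1.isLt
  simp only [partialParityCheck, diagonalColumns_apply, Matrix.submatrix_apply, Matrix.of_apply, id,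
    Fin.val_last]
  split_ifs with h1
  · refine coeff_eq_zero_of_natDegree_lt (lt_of_le_of_lt ?_ (hlt.trans_le ?_))
    · exact Finset.le_sup (f := fun j => (H i j).natDegree) (Finset.mem_univ _)
    · omega
  · rfl

theorem natDegree_le_rowDegree (H : Matrix (Fin r) (Fin n) F[X]) (i : Fin r) (j : Fin n) :
    (H i j).natDegree ≤ rowDegree H i :=
  Finset.le_sup (f := fun j => (H i j).natDegree) (Finset.mem_univ j)

theorem sum_rowDegree_eq (h : r + k = n) {δ : ℕ} (C : ConvolutionalCode F n k δ)
    (H : Matrix (Fin r) (Fin n) F[X]) (hH : IsMinimalParityCheckMatrix H C.carrier) :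
    ∑ i, rowDegree H i = δ := by
  obtain ⟨Y, hY⟩ := exists_rightInverse_of_isLeftPrime H hH.2.1
  exact sum_eq_of_linearIndependent h H _ (natDegree_le_rowDegree H) hH.2.2
    (C.sup_natDegree_dualMinor h H Y hY hH.1.2)

theorem isMinimalParityCheckMatrix_of_linearIndependent (H : Matrix (Fin r) (Fin n) F[X])
    (Y : Matrix (Fin n) (Fin r) F[X]) (hY : H * Y = 1) (ν : ℕ)
    (hd : ∀ i j, (H i j).natDegree ≤ ν) (hli : LinearIndependent F (coeffMatrix H ν).row) :
    IsMinimalParityCheckMatrix H (LinearMap.ker H.mulVecLin) := by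
  refine ⟨⟨linearIndependent_row_of_mul_eq_one H Y hY, rfl⟩, isLeftPrime_of_mul_eq_one H Y hY, ?_⟩
  have hrow : ∀ i, rowDegree H i = ν := by
    intro i
    refine le_antisymm (Finset.sup_le fun j _ => hd i j) ?_
    obtain ⟨j, hj⟩ := Function.ne_iff.1 (hli.ne_zero i)
    exact (le_natDegree_of_ne_zero hj).trans (natDegree_le_rowDegree H i j)
  have h1 : (Matrix.of fun i j => (H i j).coeff (rowDegree H i)) = coeffMatrix H ν := by
    ext i j
    simp [hrow, coeffMatrix]
  rw [IsRowProper, h1]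
  exact hli

/-- The conditions on the dual of a code with parameters `r`, `ν`, `L` that characterize complete
MDP codes. -/
def HasTrivialDuals (C : Submodule F[X] (Fin n → F[X])) (r ν L : ℕ) : Prop :=
  TrivialDual C (Finset.univ ×ˢ Finset.range ν) ∧
    ∀ J : Fin (L + 1) × Fin r ↪ Fin (ν + L + 1) × Fin n,
      ¬ IsTriviallyZero F ν L J → TrivialDual C (coSupport J)

theorem hasTrivialDuals_ker (H : Matrix (Fin r) (Fin n) F[X])
    (Y : Matrix (Fin n) (Fin r) F[X]) (hY : H * Y = 1) (ν L : ℕ)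
    (hd : ∀ i j, (H i j).natDegree ≤ ν) (hli : LinearIndependent F (coeffMatrix H ν).row)
    (hJ : ∀ J : Fin (L + 1) × Fin r ↪ Fin (ν + L + 1) × Fin n,
      ¬ IsTriviallyZero F ν L J → fullMinor (coeffMatrix H) ν L J ≠ 0) :
    HasTrivialDuals (LinearMap.ker H.mulVecLin) r ν L :=
  ⟨trivialDual_range H Y hY ν hd hli, fun J h0 =>
    trivialDual_coSupport H Y hY ν L hd hli J (hJ J h0)⟩

theorem eq_const_of_sum_eq {ν δ : ℕ} (d : Fin r → ℕ) (hle : ∀ i, ν ≤ d i)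
    (hsum : ∑ i, d i = δ) (hδ : r * ν = δ) (i : Fin r) : d i = ν := by
  have h1 : ∑ i : Fin r, ν = ∑ i, d i := by rw [hsum, ← hδ]; simp
  exact ((Finset.sum_eq_sum_iff_of_le fun i _ => hle i).1 h1 i (Finset.mem_univ i)).symm

theorem matrixDegree_eq_of_rowDegree_eq (hr : 0 < r) (H : Matrix (Fin r) (Fin n) F[X]) {ν : ℕ}
    (hrow : ∀ i, rowDegree H i = ν) : matrixDegree H = ν := by
  refine le_antisymm (Finset.sup_le fun i _ => (hrow i).le) ?_
  rw [← hrow ⟨0, hr⟩]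
  exact Finset.le_sup (f := rowDegree H) (Finset.mem_univ _)

/-- The defining property of complete MDP codes, with the number `r` of rows of the parity-check
matrices and the length `L` as parameters. -/
def HasNonzeroMinors (C : Submodule F[X] (Fin n → F[X])) (r L : ℕ) : Prop :=
  (∃ H : Matrix (Fin r) (Fin n) F[X], IsMinimalParityCheckMatrix H C) ∧
  ∀ H : Matrix (Fin r) (Fin n) F[X], IsMinimalParityCheckMatrix H C →
    ∀ J : Fin (L + 1) × Fin r ↪ Fin (matrixDegree H + L + 1) × Fin n,
      ¬ IsTriviallyZero F (matrixDegree H) L J → fullMinor (coeffMatrix H) (matrixDegree H) L J ≠ 0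

/-- Frees the property from the choice of `H`. In both directions the row degrees are shown to equal
`ν`: by the diagonal minor in one, by the absence of dual words of degree below `ν` in the other. -/
theorem hasNonzeroMinors_iff (h : r + k = n) (hr : 0 < r) {δ ν : ℕ} (hδ : r * ν = δ) (L : ℕ)
    (C : NoncatastrophicCode F n k δ) :
    HasNonzeroMinors C.1.carrier r L ↔ HasTrivialDuals C.1.carrier r ν L := by
  constructor
  · rintro ⟨⟨H, hH⟩, hall⟩
    have hrow := rowDegree_eq_of_fullMinor_ne_zero (by omega) H L
      (hall H hH _ (not_isTriviallyZero_diagonalColumns F (by omega) _ L))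
    have hsum := sum_rowDegree_eq h C.1 H hH
    have hdeg : matrixDegree H = ν := by
      simp only [hrow, Finset.sum_const, Finset.card_univ, Fintype.card_fin, smul_eq_mul] at hsum
      exact Nat.eq_of_mul_eq_mul_left hr (hsum.trans hδ.symm)
    obtain ⟨Y, hY⟩ := exists_rightInverse_of_isLeftPrime H hH.2.1
    rw [hH.1.2]
    have hli : LinearIndependent F (coeffMatrix H ν).row := by
      have h1 := hH.2.2
      simp only [IsRowProper, hrow, hdeg] at h1
      exact h1
    -- The degree becomes a variable because the type of `J` depends on it.
    have hmin : ∀ m, m = matrixDegree H → ∀ J : Fin (L + 1) × Fin r ↪ Fin (m + L + 1) × Fin n,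
        ¬ IsTriviallyZero F m L J → fullMinor (coeffMatrix H) m L J ≠ 0 := by
      rintro _ rfl
      exact hall H hH
    refine hasTrivialDuals_ker H Y hY ν L (fun i j => ?_) hli (hmin ν hdeg.symm)
    rw [← hdeg, ← hrow i]
    exact natDegree_le_rowDegree H i j
  · rintro ⟨ht, hJ⟩
    constructor
    · obtain ⟨H, Y, d, hY, hC, hd, hsum, hli⟩ := exists_rowReduced_parityCheck h C
      rw [hC] at ht ⊢
      have hconst := eq_const_of_sum_eq d (le_of_trivialDual_range H Y hY ν ht d hd) hsum hδ
      refine ⟨H, isMinimalParityCheckMatrix_of_linearIndependent H Y hY ν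
        (fun i j => (hd i j).trans_eq (hconst i)) ?_⟩
      simp only [hconst] at hli
      exact hli
    · intro H hH
      obtain ⟨Y, hY⟩ := exists_rightInverse_of_isLeftPrime H hH.2.1
      have hsum := sum_rowDegree_eq h C.1 H hH
      rw [hH.1.2] at ht hJ
      have hconst := eq_const_of_sum_eq _ (le_of_trivialDual_range H Y hY ν ht _
        (natDegree_le_rowDegree H)) hsum hδ
      have hdeg := matrixDegree_eq_of_rowDegree_eq hr H hconst
      have hmin : ∀ m, m = ν → ∀ J : Fin (L + 1) × Fin r ↪ Fin (m + L + 1) × Fin n,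
          ¬ IsTriviallyZero F m L J → fullMinor (coeffMatrix H) m L J ≠ 0 := by
        intro m hm J h0
        subst hm
        exact fullMinor_ne_zero_of_trivialDual H Y hY _ L
          (fun i j => (natDegree_le_rowDegree H i j).trans_eq (hconst i)) J (hJ J h0)
      exact hmin _ hdeg

theorem isOpen_setOf_hasTrivialDuals {δ : ℕ} (hkn : k ≤ n) (r ν L : ℕ) :
    IsOpen {C : NoncatastrophicCode F n k δ | HasTrivialDuals C.1.carrier r ν L} := by
  have h1 : {C : NoncatastrophicCode F n k δ | HasTrivialDuals C.1.carrier r ν L}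
      = {C | TrivialDual C.1.carrier (Finset.univ ×ˢ Finset.range ν)} ∩
        ⋂ J : {J : Fin (L + 1) × Fin r ↪ Fin (ν + L + 1) × Fin n // ¬ IsTriviallyZero F ν L J},
          {C | TrivialDual C.1.carrier (coSupport J.1)} := by
    ext C
    simp [HasTrivialDuals]
  rw [h1]
  exact (isOpen_setOf_trivialDual hkn _).inter
    (isOpen_iInter_of_finite fun J => isOpen_setOf_trivialDual hkn _)

end CompleteMDP

/-! ### Specialization of parity-check matrices with parameters -/

section Specialization

variable {r k n : ℕ} (h : r + k = n)

theorem dualMinors_map {R S : Type*} [CommRing R] [CommRing S] (φ : R →+* S)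
    (H : Matrix (Fin r) (Fin n) R[X]) (I : Fin k ↪o Fin n) :
    dualMinors h (H.map (mapRingHom φ)) I = (dualMinors h H I).map φ :=
  dualMinor_map h (mapRingHom φ) H I

theorem shiftMinor_dualMinors_map {R S : Type*} [CommRing R] [CommRing S] (φ : R →+* S)
    (H : Matrix (Fin r) (Fin n) R[X]) (δ : ℕ)
    (e : Fin (2 * δ + 1) → (Fin k ↪o Fin n) × Fin (δ + 1)) :
    shiftMinor (dualMinors h (H.map (mapRingHom φ))) δ e
      = φ (shiftMinor (dualMinors h H) δ e) := by
  rw [← shiftMinor_map]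
  congr 1
  exact funext fun I => dualMinors_map h φ H I

theorem eval_coeff_dualMinors_map {F R : Type*} [Field F] [CommRing R] [Algebra F R]
    (φ : R →ₐ[F] F) (H : Matrix (Fin r) (Fin n) R[X]) {δ : ℕ}
    (f : MvPolynomial (PluckerIndex n k δ) F) :
    MvPolynomial.eval (fun q : PluckerIndex n k δ =>
        (dualMinors h (H.map (mapRingHom φ.toRingHom)) q.1).coeff q.2.val) f
      = φ (MvPolynomial.aeval (fun q : PluckerIndex n k δ =>
        (dualMinors h H q.1).coeff q.2.val) f) := by
  rw [← AlgHom.comp_apply, MvPolynomial.comp_aeval, ← MvPolynomial.coe_aeval_eq_eval]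
  simp only [dualMinors_map, coeff_map]
  rfl

end Specialization

/-! ### Balancing the row degrees -/

section Balancing

variable {F : Type*} [Field F] {r k n : ℕ} (h : r + k = n)

theorem sum_eq_add_add {ι M : Type*} [Fintype ι] [DecidableEq ι] [AddCommMonoid M] {a b : ι}
    (hab : a ≠ b) (g : ι → M) :
    ∑ i, g i = g a + (g b + ∑ i ∈ (Finset.univ.erase a).erase b, g i) := by
  rw [Finset.add_sum_erase _ _ (Finset.mem_erase.2 ⟨hab.symm, Finset.mem_univ b⟩),
    Finset.add_sum_erase _ _ (Finset.mem_univ a)]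

theorem dualMinor_transvection {R : Type*} [CommRing R] (H : Matrix (Fin r) (Fin n) R)
    {a b : Fin r} (hab : a ≠ b) (c : R) (I : Fin k → Fin n) :
    dualMinor h (H.updateRow a (H a + c • H b)) I = dualMinor h H I := by
  have h1 : H.updateRow a (H a + c • H b) = Matrix.transvection a b c * H := by
    ext i j
    by_cases hi : i = a
    · subst hi
      simp
    · simp [hi]
  rw [h1, dualMinor_mul, Matrix.det_transvection_of_ne _ _ hab, one_mul]

/-- Adding `t` times the shifted row `a` to row `b` is a deformation with value `H` at `t = 0`, so
both nonvanishing conditions persist for almost all `t`. For `t ≠ 0` a row operation then cancels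
the high terms of row `a`, and the degrees `d a`, `d b` become `d b + 1`, `d a - 1`. -/
theorem exists_more_balanced [Infinite F] {δ : ℕ} (H : Matrix (Fin r) (Fin n) F[X])
    (d : Fin r → ℕ) (hd : ∀ i j, (H i j).natDegree ≤ d i)
    (e : Fin (2 * δ + 1) → (Fin k ↪o Fin n) × Fin (δ + 1))
    (he : shiftMinor (dualMinors h H) δ e ≠ 0)
    (f : MvPolynomial (PluckerIndex n k δ) F)
    (hf : MvPolynomial.eval (fun q : PluckerIndex n k δ =>
      (dualMinors h H q.1).coeff q.2.val) f ≠ 0) {a b : Fin r} (hab : d b + 2 ≤ d a) :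
    ∃ (H' : Matrix (Fin r) (Fin n) F[X]) (d' : Fin r → ℕ),
      (∀ i j, (H' i j).natDegree ≤ d' i) ∧ ∑ i, d' i = ∑ i, d i ∧
      ∑ i, d' i ^ 2 < ∑ i, d i ^ 2 ∧ shiftMinor (dualMinors h H') δ e ≠ 0 ∧
      MvPolynomial.eval (fun q : PluckerIndex n k δ =>
        (dualMinors h H' q.1).coeff q.2.val) f ≠ 0 := by
  have hne : a ≠ b := by
    rintro rfl
    omega
  -- The whole family as one matrix over `F[t][z]`: the inner variable is the parameter `t`, and `Ht
  -- t` is its specialization.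
  let P : Matrix (Fin r) (Fin n) F[X][X] := (H.map (mapRingHom C)).updateRow b fun j =>
    (H b j).map C + C X * ((H a j).divX).map C
  let Ht : F → Matrix (Fin r) (Fin n) F[X] := fun t =>
    H.updateRow b fun j => H b j + C t * (H a j).divX
  have hP : ∀ t, P.map (mapRingHom (aeval (R := F) t).toRingHom) = Ht t := by
    intro t
    have hC : (evalRingHom t).comp C = RingHom.id F := by
      ext x
      simp
    ext1 i j
    by_cases hi : i = b
    · subst hi
      simp [P, Ht, Polynomial.map_map, hC]
    · simp [P, Ht, Polynomial.map_map, hC, hi]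
  have hH0 : Ht 0 = H := by
    simp only [Ht, map_zero, zero_mul, add_zero]
    exact Matrix.updateRow_eq_self H b
  have hs : ∀ t, shiftMinor (dualMinors h (Ht t)) δ e
      = (shiftMinor (dualMinors h P) δ e).eval t := by
    intro t
    rw [← hP, shiftMinor_dualMinors_map]
    simp
  have hfe : ∀ t, MvPolynomial.eval (fun q : PluckerIndex n k δ =>
      (dualMinors h (Ht t) q.1).coeff q.2.val) f
      = (MvPolynomial.aeval (fun q : PluckerIndex n k δ =>
        (dualMinors h P q.1).coeff q.2.val) f).eval t := by
    intro t
    rw [← hP, eval_coeff_dualMinors_map]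
    simp [aeval_def, eval₂_eq_eval_map]
  -- The factor `X` forces `t ≠ 0`.
  obtain ⟨t, ht⟩ : ∃ t : F, (X * (shiftMinor (dualMinors h P) δ e * MvPolynomial.aeval
      (fun q : PluckerIndex n k δ => (dualMinors h P q.1).coeff q.2.val) f)).eval t ≠ 0 := by
    by_contra! hall
    have h0 := Polynomial.funext (q := 0) fun t => (hall t).trans eval_zero.symm
    have h1 := (mul_eq_zero.1 h0).resolve_left X_ne_zero
    have h2 := congrArg (Polynomial.eval 0) h1
    rw [eval_mul, ← hs, ← hfe, hH0, eval_zero] at h2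
    exact (mul_ne_zero he hf) h2
  rw [eval_mul, eval_mul, eval_X, ← hs, ← hfe] at ht
  have ht0 : t ≠ 0 := left_ne_zero_of_mul ht
  have ht1 := left_ne_zero_of_mul (right_ne_zero_of_mul ht)
  have ht2 := right_ne_zero_of_mul (right_ne_zero_of_mul ht)
  -- Subtracting `t⁻¹ z` times the new row `b` leaves only the constant term of row `a` and `-t⁻¹ z`
  -- times the old row `b`. The operation has determinant one and preserves the dual minors.
  let H' : Matrix (Fin r) (Fin n) F[X] :=
    (Ht t).updateRow a (Ht t a + (-(C t⁻¹ * X)) • Ht t b)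
  have hminors : dualMinors (k := k) h H' = dualMinors h (Ht t) :=
    funext fun I => dualMinor_transvection h (Ht t) hne _ _
  have hH'a : ∀ j, H' a j = C ((H a j).coeff 0) - C t⁻¹ * X * H b j := by
    intro j
    have h1 : (C t⁻¹ * C t : F[X]) = 1 := by rw [← C_mul, inv_mul_cancel₀ ht0, C_1]
    have h2 := divX_mul_X_add (H a j)
    simp only [H', Ht, Matrix.updateRow_self, Matrix.updateRow_ne hne, Pi.add_apply,
      Pi.smul_apply, smul_eq_mul]
    linear_combination -h2 - X * (H a j).divX * h1
  have hH'b : ∀ j, H' b j = H b j + C t * (H a j).divX := by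
    intro j
    simp only [H', Ht, Matrix.updateRow_self, Matrix.updateRow_ne hne.symm]
  have hH' : ∀ i j, i ≠ a → i ≠ b → H' i j = H i j := by
    intro i j hia hib
    simp only [H', Ht, Matrix.updateRow_ne hia, Matrix.updateRow_ne hib]
  let d' : Fin r → ℕ := Function.update (Function.update d a (d b + 1)) b (d a - 1)
  have hd'a : d' a = d b + 1 := by simp [d', hne]
  have hd'b : d' b = d a - 1 := by simp [d']
  have hd' : ∀ i, i ≠ a → i ≠ b → d' i = d i := fun i hia hib => by simp [d', hia, hib]
  have hrest : ∀ g : ℕ → ℕ, ∑ i ∈ (Finset.univ.erase a).erase b, g (d' i)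
      = ∑ i ∈ (Finset.univ.erase a).erase b, g (d i) := fun g => by
    refine Finset.sum_congr rfl fun i hi => ?_
    simp only [Finset.mem_erase, Finset.mem_univ, and_true] at hi
    rw [hd' i hi.2 hi.1]
  refine ⟨H', d', ?_, ?_, ?_, by rwa [hminors], by rwa [hminors]⟩
  · intro i j
    by_cases hia : i = a
    · subst hia
      rw [hH'a, hd'a]
      refine (natDegree_sub_le _ _).trans (max_le (by simp) ?_)
      rw [mul_assoc]
      refine (natDegree_C_mul_le _ _).trans ?_
      rw [add_comm]
      exact natDegree_mul_le_of_le natDegree_X_le (hd b j)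
    · by_cases hib : i = b
      · subst hib
        rw [hH'b, hd'b]
        refine (natDegree_add_le _ _).trans (max_le ((hd i j).trans (by omega)) ?_)
        refine (natDegree_C_mul_le _ _).trans ?_
        rw [natDegree_divX_eq_natDegree_tsub_one]
        exact Nat.sub_le_sub_right (hd a j) 1
      · rw [hH' i j hia hib, hd' i hia hib]
        exact hd i j
  · rw [sum_eq_add_add hne, sum_eq_add_add hne d, hd'a, hd'b, hrest fun x => x]
    omega
  · rw [sum_eq_add_add hne, sum_eq_add_add hne fun i => d i ^ 2, hd'a, hd'b, hrest fun x => x ^ 2]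
    obtain ⟨c, hc⟩ := Nat.exists_eq_add_of_le hab
    rw [hc, show d b + 2 + c - 1 = d b + 1 + c by omega]
    nlinarith

theorem exists_balanced [Infinite F] {δ ν : ℕ} (hδ : r * ν = δ) (C : NoncatastrophicCode F n k δ)
    {D : ℕ} (f : MvPolynomial (PluckerIndex n k δ) F) (hhom : f.IsHomogeneous D)
    (hf : MvPolynomial.eval (pluckerVector δ C.1.generatorMatrix) f ≠ 0) :
    ∃ (H : Matrix (Fin r) (Fin n) F[X])
      (e : Fin (2 * δ + 1) → (Fin k ↪o Fin n) × Fin (δ + 1)),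
      (∀ i j, (H i j).natDegree ≤ ν) ∧ shiftMinor (dualMinors h H) δ e ≠ 0 ∧
      MvPolynomial.eval (fun q : PluckerIndex n k δ =>
        (dualMinors h H q.1).coeff q.2.val) f ≠ 0 := by
  classical
  obtain ⟨H₀, Y, d₀, hY, hC, hd₀, hsum₀, -⟩ := exists_rowReduced_parityCheck h C
  obtain ⟨e, he⟩ := exists_shiftMinor_dualMinors_ne_zero h C H₀ Y hY hC
  -- The sum of the squared degrees is minimized. At the minimum no degree exceeds the average `ν`,
  -- for otherwise another would lie below it and the pair could be balanced.
  have hex : ∃ (N : ℕ) (H : Matrix (Fin r) (Fin n) F[X]) (d : Fin r → ℕ),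
      (∀ i j, (H i j).natDegree ≤ d i) ∧ ∑ i, d i = δ ∧ ∑ i, d i ^ 2 = N ∧
      shiftMinor (dualMinors h H) δ e ≠ 0 ∧
      MvPolynomial.eval (fun q : PluckerIndex n k δ =>
        (dualMinors h H q.1).coeff q.2.val) f ≠ 0 :=
    ⟨_, H₀, d₀, hd₀, hsum₀, rfl, he, (eval_pluckerVector_ne_zero_iff h C H₀ Y hY hC hhom).1 hf⟩
  obtain ⟨H, d, hd, hsum, hsq, he', hf'⟩ := Nat.find_spec hex
  refine ⟨H, e, fun i j => (hd i j).trans ?_, he', hf'⟩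
  by_contra! hlt
  obtain ⟨b, hb⟩ : ∃ b, d b < ν := by
    by_contra! hge
    have h1 := Finset.sum_lt_sum (fun i _ => hge i) ⟨i, Finset.mem_univ i, hlt⟩
    rw [hsum, ← hδ] at h1
    simp at h1
  obtain ⟨H', d', hd', hsum', hsq', he'', hf''⟩ :=
    exists_more_balanced h H d hd e he' f hf' (a := i) (b := b) (by omega)
  exact Nat.find_min hex (hsq ▸ hsq') ⟨H', d', hd', hsum'.trans hsum, rfl, he'', hf''⟩

end Balancing

/-! ### The generic parity-check matrix -/

section Generic

/-- The polynomial matrix of degree at most `ν` with the coefficients `x (i, a, b)`. -/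
def polyMatrix {R : Type*} [CommRing R] {r n : ℕ} (ν : ℕ) (x : ℕ × Fin r × Fin n → R) :
    Matrix (Fin r) (Fin n) R[X] :=
  Matrix.of fun a b => ∑ i ∈ Finset.range (ν + 1), monomial i (x (i, a, b))

variable {r k n : ℕ}

theorem polyMatrix_map {R S : Type*} [CommRing R] [CommRing S] (φ : R →+* S) (ν : ℕ)
    (x : ℕ × Fin r × Fin n → R) :
    (polyMatrix ν x).map (mapRingHom φ) = polyMatrix ν fun t => φ (x t) := by
  ext1 a b
  simp [polyMatrix, Polynomial.map_sum]

theorem natDegree_polyMatrix_le {R : Type*} [CommRing R] (ν : ℕ) (x : ℕ × Fin r × Fin n → R)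
    (a : Fin r) (b : Fin n) : (polyMatrix ν x a b).natDegree ≤ ν :=
  natDegree_sum_le_of_forall_le _ _ fun _ hi =>
    (natDegree_monomial_le _).trans (Nat.lt_succ_iff.1 (Finset.mem_range.1 hi))

theorem coeff_polyMatrix {R : Type*} [CommRing R] (ν : ℕ) (x : ℕ × Fin r × Fin n → R)
    {i : ℕ} (hi : i ≤ ν) (a : Fin r) (b : Fin n) :
    (polyMatrix ν x a b).coeff i = x (i, a, b) := by
  simp only [polyMatrix, Matrix.of_apply, finsetSum_coeff, coeff_monomial]
  rw [Finset.sum_ite_eq' , if_pos (Finset.mem_range.2 (Nat.lt_succ_of_le hi))]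

theorem eq_polyMatrix {R : Type*} [CommRing R] (ν : ℕ) (H : Matrix (Fin r) (Fin n) R[X])
    (hd : ∀ i j, (H i j).natDegree ≤ ν) :
    H = polyMatrix ν fun t => (H t.2.1 t.2.2).coeff t.1 := by
  ext1 a b
  exact as_sum_range' _ _ (Nat.lt_succ_of_le (hd a b))

theorem fullMinor_congr {R : Type*} [CommRing R] (A B : ℕ → Matrix (Fin r) (Fin n) R) (ν L : ℕ)
    (hAB : ∀ i ≤ ν, A i = B i) (J : Fin (L + 1) × Fin r ↪ Fin (ν + L + 1) × Fin n) :
    fullMinor A ν L J = fullMinor B ν L J := by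
  rw [fullMinor, fullMinor]
  congr 2
  ext p q
  simp only [partialParityCheck, Matrix.of_apply]
  split_ifs with h1
  · rw [hAB _ (by omega)]
  · rfl

theorem fullMinor_polyMatrix {F : Type*} [Field F] (ν L : ℕ) (x : ℕ × Fin r × Fin n → F)
    (J : Fin (L + 1) × Fin r ↪ Fin (ν + L + 1) × Fin n) :
    fullMinor (coeffMatrix (polyMatrix ν x)) ν L J
      = MvPolynomial.eval x (fullMinor (genericCoeff F r n) ν L J) := by
  rw [← fullMinor_map]
  refine fullMinor_congr _ _ ν L (fun i hi => ?_) J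
  ext a b
  simp [coeffMatrix, coeff_polyMatrix ν x hi, genericCoeff]

variable (h : r + k = n)

/-- The minor `shiftMinor` of the dual minors of the polynomial matrix of degree `ν` whose
coefficients are indeterminates. -/
def genericShiftMinor (R : Type*) [CommRing R] (ν δ : ℕ)
    (e : Fin (2 * δ + 1) → (Fin k ↪o Fin n) × Fin (δ + 1)) :
    MvPolynomial (ℕ × Fin r × Fin n) R :=
  shiftMinor (dualMinors h (polyMatrix ν MvPolynomial.X)) δ e

theorem eval_genericShiftMinor {R : Type*} [CommRing R] (ν δ : ℕ)
    (e : Fin (2 * δ + 1) → (Fin k ↪o Fin n) × Fin (δ + 1)) (x : ℕ × Fin r × Fin n → R) :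
    MvPolynomial.eval x (genericShiftMinor h R ν δ e)
      = shiftMinor (dualMinors h (polyMatrix ν x)) δ e := by
  rw [genericShiftMinor, ← shiftMinor_dualMinors_map, polyMatrix_map]
  simp

theorem totalDegree_map_le {R S σ : Type*} [CommRing R] [CommRing S] (φ : R →+* S)
    (p : MvPolynomial σ R) : (MvPolynomial.map φ p).totalDegree ≤ p.totalDegree :=
  Finset.sup_mono (MvPolynomial.support_map_subset φ p)

/-- The integral polynomial gives a degree bound that is the same for all fields. -/
theorem totalDegree_genericShiftMinor_le (F : Type*) [Field F] (ν δ : ℕ)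
    (e : Fin (2 * δ + 1) → (Fin k ↪o Fin n) × Fin (δ + 1)) :
    (genericShiftMinor h F ν δ e).totalDegree ≤ (genericShiftMinor h ℤ ν δ e).totalDegree := by
  have h1 : genericShiftMinor h F ν δ e
      = MvPolynomial.map (Int.castRingHom F) (genericShiftMinor h ℤ ν δ e) := by
    rw [genericShiftMinor, genericShiftMinor, ← shiftMinor_dualMinors_map, polyMatrix_map]
    simp
  rw [h1]
  exact totalDegree_map_le _ _

theorem totalDegree_fullMinor_le (F : Type*) [Field F] (ν L : ℕ)
    (J : Fin (L + 1) × Fin r ↪ Fin (ν + L + 1) × Fin n) :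
    (fullMinor (genericCoeff F r n) ν L J).totalDegree ≤
      (fullMinor (fun i => Matrix.of fun a b =>
        (MvPolynomial.X (i, a, b) : MvPolynomial (ℕ × Fin r × Fin n) ℤ)) ν L J).totalDegree := by
  have h1 : genericCoeff F r n = fun i => (Matrix.of fun a b =>
      (MvPolynomial.X (i, a, b) : MvPolynomial (ℕ × Fin r × Fin n) ℤ)).map
        (MvPolynomial.map (Int.castRingHom F)) := by
    funext i
    ext1 a b
    simp [genericCoeff]
  rw [h1, fullMinor_map]
  exact totalDegree_map_le _ _

open Classical in
/-- The product of all full size minors of the generic partial parity-check matrix that are not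
trivially zero. -/
def minorProduct (F : Type*) [Field F] (r n ν L : ℕ) : MvPolynomial (ℕ × Fin r × Fin n) F :=
  ∏ J ∈ Finset.univ.filter fun J : Fin (L + 1) × Fin r ↪ Fin (ν + L + 1) × Fin n =>
    ¬ IsTriviallyZero F ν L J, fullMinor (genericCoeff F r n) ν L J

theorem minorProduct_ne_zero (F : Type*) [Field F] (r n ν L : ℕ) : minorProduct F r n ν L ≠ 0 := by
  classical
  exact Finset.prod_ne_zero_iff.2 fun _ hJ => (Finset.mem_filter.1 hJ).2

theorem totalDegree_minorProduct_le (F : Type*) [Field F] (r n ν L : ℕ) :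
    (minorProduct F r n ν L).totalDegree ≤
      ∑ J : Fin (L + 1) × Fin r ↪ Fin (ν + L + 1) × Fin n,
        (fullMinor (fun i => Matrix.of fun a b =>
          (MvPolynomial.X (i, a, b) : MvPolynomial (ℕ × Fin r × Fin n) ℤ)) ν L J).totalDegree := by
  classical
  refine (MvPolynomial.totalDegree_finsetProd _ _).trans ?_
  refine (Finset.sum_le_sum fun J _ => totalDegree_fullMinor_le F ν L J).trans ?_
  exact Finset.sum_le_sum_of_subset (Finset.filter_subset _ _)

/-- A point where the generic polynomials do not vanish yields a code. -/
theorem exists_code_of_eval_ne_zero {F : Type*} [Field F] {ν δ : ℕ} (hδ : r * ν = δ) (L : ℕ)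
    (e : Fin (2 * δ + 1) → (Fin k ↪o Fin n) × Fin (δ + 1)) (x : ℕ × Fin r × Fin n → F)
    (h1 : MvPolynomial.eval x (genericShiftMinor h F ν δ e) ≠ 0)
    (h2 : MvPolynomial.eval x (minorProduct F r n ν L) ≠ 0) :
    ∃ (C : NoncatastrophicCode F n k δ) (Y : Matrix (Fin n) (Fin r) F[X]),
      polyMatrix ν x * Y = 1 ∧ C.1.carrier = LinearMap.ker (polyMatrix ν x).mulVecLin ∧
      HasTrivialDuals C.1.carrier r ν L := by
  classical
  rw [eval_genericShiftMinor] at h1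
  have hd := natDegree_polyMatrix_le ν x
  have hsum : ∑ _i : Fin r, ν = δ := by simpa using hδ
  obtain ⟨⟨Y, hY⟩, hsup⟩ := exists_rightInverse_of_shiftMinor h _ (fun _ => ν) hd hsum e h1
  refine ⟨ofParityCheck h _ Y hY δ hsup, Y, hY, rfl, ?_⟩
  refine hasTrivialDuals_ker _ Y hY ν L hd ?_ fun J hJ => ?_
  · obtain ⟨I, hI⟩ := exists_coeff_ne_zero_of_shiftMinor_ne_zero _
      (fun I => hsum ▸ natDegree_dualMinor_le h _ (fun _ => ν) hd I) h1
    rw [dualMinors, ← hsum, coeff_dualMinor h _ (fun _ => ν) hd] at hI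
    exact linearIndependent_row_of_dualMinor_ne_zero h _ I hI
  · rw [fullMinor_polyMatrix]
    rw [minorProduct, map_prod] at h2
    exact Finset.prod_ne_zero_iff.1 h2 J (Finset.mem_filter.2 ⟨Finset.mem_univ J, hJ⟩)

/-- The matrix with `z^ν` on the diagonal and ones next to it. -/
def bidiagonal (F : Type*) [Field F] (r n ν : ℕ) : Matrix (Fin r) (Fin n) F[X] :=
  Matrix.of fun i j => if j.val = i.val then X ^ ν else if j.val = i.val + 1 then 1 else 0

theorem natDegree_bidiagonal_le (F : Type*) [Field F] (ν : ℕ) (i : Fin r) (j : Fin n) :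
    (bidiagonal F r n ν i j).natDegree ≤ ν := by
  simp only [bidiagonal, Matrix.of_apply]
  split_ifs <;> simp

theorem exists_rightInverse_bidiagonal (F : Type*) [Field F] (hrn : r < n) (ν : ℕ) :
    ∃ Y : Matrix (Fin n) (Fin r) F[X], bidiagonal F r n ν * Y = 1 := by
  let g : Fin r → Fin n := fun j => ⟨j.val + 1, by omega⟩
  have hdet : ((bidiagonal F r n ν).submatrix id g).det = 1 := by
    rw [Matrix.det_of_isLowerTriangular]
    · simp [bidiagonal, g]
    · intro i j hij
      have h1 : i.val < j.val := hij
      simp only [bidiagonal, g, Matrix.submatrix_apply, Matrix.of_apply, id]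
      rw [if_neg (by omega), if_neg (by omega)]
  refine ⟨(1 : Matrix (Fin n) (Fin n) F[X]).submatrix id g *
    ((bidiagonal F r n ν).submatrix id g)⁻¹, ?_⟩
  have h1 : bidiagonal F r n ν * (1 : Matrix (Fin n) (Fin n) F[X]).submatrix id g
      = (bidiagonal F r n ν).submatrix id g := by
    ext1 i j
    simp [Matrix.mul_apply, Matrix.one_apply]
  rw [← Matrix.mul_assoc, h1, Matrix.mul_nonsing_inv _ (by rw [hdet]; exact isUnit_one)]

theorem linearIndependent_coeffMatrix_bidiagonal (F : Type*) [Field F] (hrn : r < n) (ν : ℕ) :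
    LinearIndependent F (coeffMatrix (bidiagonal F r n ν) ν).row := by
  let g : Fin r → Fin n := Fin.castLE hrn.le
  have hdet : ((coeffMatrix (bidiagonal F r n ν) ν).submatrix id g).det = 1 := by
    rw [Matrix.det_of_isUpperTriangular]
    · simp [coeffMatrix, bidiagonal, g]
    · intro i j hij
      have h1 : j.val < i.val := hij
      simp only [coeffMatrix, bidiagonal, g, Matrix.submatrix_apply, Matrix.of_apply, id,
        Matrix.map_apply, Fin.val_castLE]
      rw [if_neg (by omega), if_neg (by omega), coeff_zero]
  have h1 : LinearIndependent F ((coeffMatrix (bidiagonal F r n ν) ν).submatrix id g).row :=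
    Matrix.linearIndependent_rows_iff_isUnit.2
      ((Matrix.isUnit_iff_isUnit_det _).2 (by rw [hdet]; exact isUnit_one))
  exact LinearIndependent.of_comp (LinearMap.funLeft F F g) h1

/-- The bidiagonal matrix is left prime, its unit entries next to the diagonal giving a minor `1`,
and row proper with all degrees `ν`. Hence it defines a code at which some `shiftMinor` is nonzero.
-/
theorem exists_genericShiftMinor_ne_zero (hk : 0 < k) (F : Type*) [Field F] {ν δ : ℕ}
    (hδ : r * ν = δ) : ∃ e, genericShiftMinor h F ν δ e ≠ 0 := by
  obtain ⟨Y, hY⟩ := exists_rightInverse_bidiagonal F (show r < n by omega) ν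
  have hd := natDegree_bidiagonal_le (r := r) (n := n) F ν
  have hsup := sum_eq_of_linearIndependent h _ (fun _ => ν) hd
    (linearIndependent_coeffMatrix_bidiagonal F (show r < n by omega) ν) rfl
  rw [show ∑ _i : Fin r, ν = δ by simpa using hδ] at hsup
  obtain ⟨e, he⟩ := exists_shiftMinor_dualMinors_ne_zero h
    (ofParityCheck h _ Y hY δ hsup.symm) _ Y hY rfl
  refine ⟨e, fun h0 => he ?_⟩
  rw [eq_polyMatrix ν _ hd, ← eval_genericShiftMinor, h0, map_zero]

/-! ### Existence over large fields and density over infinite fields. -/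

/-- Over sufficiently large fields there are codes with trivial duals. -/
theorem exists_code_hasTrivialDuals (h : r + k = n) (hk : 0 < k) {ν δ : ℕ} (hδ : r * ν = δ) (L : ℕ) :
    ∃ N : ℕ, ∀ (F : Type*) [Field F], (N : ℕ∞) ≤ ENat.card F →
      ∃ C : NoncatastrophicCode F n k δ, HasTrivialDuals C.1.carrier r ν L := by
  classical
  -- The choice of `e` may depend on the field, so the bound sums over all `e`.
  refine ⟨∑ e : Fin (2 * δ + 1) → (Fin k ↪o Fin n) × Fin (δ + 1),
    (genericShiftMinor h ℤ ν δ e).totalDegree +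
    ∑ J : Fin (L + 1) × Fin r ↪ Fin (ν + L + 1) × Fin n,
        (fullMinor (fun i => Matrix.of fun a b =>
          (MvPolynomial.X (i, a, b) : MvPolynomial (ℕ × Fin r × Fin n) ℤ)) ν L J).totalDegree + 1,
    fun F _ hF => ?_⟩
  obtain ⟨e, he⟩ := exists_genericShiftMinor_ne_zero h hk F hδ
  obtain ⟨x, hx⟩ := exists_eval_ne_zero (genericShiftMinor h F ν δ e * minorProduct F r n ν L)
    (mul_ne_zero he (minorProduct_ne_zero F r n ν L)) (by
      refine le_trans (Nat.cast_le.2 (Nat.succ_le_succ ?_)) hF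
      refine (MvPolynomial.totalDegree_mul _ _).trans (add_le_add ?_
        (totalDegree_minorProduct_le F r n ν L))
      exact (totalDegree_genericShiftMinor_le h F ν δ e).trans
        (Finset.single_le_sum (f := fun e => (genericShiftMinor h ℤ ν δ e).totalDegree)
          (fun _ _ => Nat.zero_le _) (Finset.mem_univ e)))
  rw [map_mul] at hx
  obtain ⟨C, -, -, -, hC⟩ := exists_code_of_eval_ne_zero h hδ L e x (left_ne_zero_of_mul hx)
    (right_ne_zero_of_mul hx)
  exact ⟨C, hC⟩

theorem dense_setOf_hasTrivialDuals (h : r + k = n) {F : Type*} [Field F] [Infinite F] {ν δ : ℕ}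
    (hδ : r * ν = δ) (L : ℕ) :
    Dense {C : NoncatastrophicCode F n k δ | HasTrivialDuals C.1.carrier r ν L} := by
  rw [dense_iff_inter_open]
  rintro U hU ⟨C₀, hC₀⟩
  obtain ⟨D, f, hhom, hf, hfU⟩ := exists_isHomogeneous_of_isOpen hU hC₀
  obtain ⟨H, e, hd, he, hfH⟩ := exists_balanced h hδ C₀ f hhom hf
  -- The form `f` pulled back to the coefficients of the generic parity-check matrix. It is nonzero
  -- because the balanced matrix `H` is a specialization of the generic one.
  let g : MvPolynomial (ℕ × Fin r × Fin n) F := MvPolynomial.aeval (fun q : PluckerIndex n k δ =>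
    (dualMinors h (polyMatrix ν MvPolynomial.X) q.1).coeff q.2.val) f
  have hg : ∀ x, MvPolynomial.eval x g = MvPolynomial.eval (fun q : PluckerIndex n k δ =>
      (dualMinors h (polyMatrix ν x) q.1).coeff q.2.val) f := by
    intro x
    have h1 := eval_coeff_dualMinors_map h (MvPolynomial.aeval x)
      (polyMatrix (r := r) (n := n) ν (MvPolynomial.X (R := F))) f
    rw [polyMatrix_map] at h1
    simp only [AlgHom.toRingHom_eq_coe, RingHom.coe_coe, MvPolynomial.aeval_X] at h1
    rw [h1]
    rfl
  have hH := eq_polyMatrix ν H hd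
  have hg0 : g ≠ 0 := fun h0 => hfH (by rw [hH, ← hg, h0, map_zero])
  have he0 : genericShiftMinor h F ν δ e ≠ 0 := fun h0 => he (by
    rw [hH, ← eval_genericShiftMinor, h0, map_zero])
  obtain ⟨x, hx⟩ := exists_eval_ne_zero
    (g * (genericShiftMinor h F ν δ e * minorProduct F r n ν L))
    (mul_ne_zero hg0 (mul_ne_zero he0 (minorProduct_ne_zero F r n ν L))) (by simp)
  rw [map_mul, map_mul] at hx
  obtain ⟨C, Y, hY, hker, hC⟩ := exists_code_of_eval_ne_zero h hδ L e x
    (left_ne_zero_of_mul (right_ne_zero_of_mul hx)) (right_ne_zero_of_mul (right_ne_zero_of_mul hx))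
  refine ⟨C, hfU C ((eval_pluckerVector_ne_zero_iff h C _ Y hY hker hhom).2 ?_), hC⟩
  rw [← hg]
  exact left_ne_zero_of_mul hx

end Generic

end ConvCode

end

/-! ### The main theorem. -/

theorem mainTheorem1 (n k δ : ℕ) (hk : 0 < k) (hkn : k < n) (hδ : (n - k) ∣ δ) :
    (∀ (K : Type*) [Field K] [IsAlgClosed K],
      IsOpen {C : ConvCode.NoncatastrophicCode K n k δ | C.1.IsCompleteMDP} ∧
      {C : ConvCode.NoncatastrophicCode K n k δ | C.1.IsCompleteMDP}.Nonempty ∧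
      Dense {C : ConvCode.NoncatastrophicCode K n k δ | C.1.IsCompleteMDP}) ∧
    ∃ N : ℕ, ∀ (F : Type*) [Field F], (N : ℕ∞) ≤ ENat.card F →
      ∃ C : ConvCode.ConvolutionalCode F n k δ, C.IsCompleteMDP := by
  have h : n - k + k = n := Nat.sub_add_cancel hkn.le
  have hr : 0 < n - k := Nat.sub_pos_of_lt hkn
  have hν : (n - k) * (δ / (n - k)) = δ := Nat.mul_div_cancel' hδ
  constructor
  · intro K _ _
    have : Infinite K := IsAlgClosed.instInfinite
    have hset : {C : ConvCode.NoncatastrophicCode K n k δ | C.1.IsCompleteMDP}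
        = {C | ConvCode.HasTrivialDuals C.1.carrier (n - k) (δ / (n - k))
            (δ / (n - k) + δ / k)} :=
      Set.ext fun C => ConvCode.hasNonzeroMinors_iff h hr hν _ C
    rw [hset]
    refine ⟨ConvCode.isOpen_setOf_hasTrivialDuals hkn.le _ _ _, ?_,
      ConvCode.dense_setOf_hasTrivialDuals h hν _⟩
    obtain ⟨N, hN⟩ := ConvCode.exists_code_hasTrivialDuals h hk hν (δ / (n - k) + δ / k)
    exact hN K (by simp)
  · obtain ⟨N, hN⟩ := ConvCode.exists_code_hasTrivialDuals h hk hν (δ / (n - k) + δ / k)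
    refine ⟨N, fun F _ hF => ?_⟩
    obtain ⟨C, hC⟩ := hN F hF
    exact ⟨C.1, (ConvCode.hasNonzeroMinors_iff h hr hν _ C).2 hC⟩
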